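/- Let $k$ be a field and $\mathcal P$ a finite poset. Let $k\mathcal P$ be the incidence algebra of $\mathcal P$ over $k$, with the multiplication $(f*g)([x,y])=\sum_{x\le z\le y} g([x,z])f([z,y])$, so that left $k\mathcal P$-modules are covariant representations of $\mathcal P$. An interval of $\mathcal P$ is a non-empty convex subset $I\subseteq\mathcal P$ that is connected as an (induced) subgraph of the Hasse diagram, and the interval module $V_I$ is the left $k\mathcal P$-module with $V_I(x)=k$ for $x\in I$, $V_I(x)=0$ for $x\notin I$, and identity structure maps $V_I(x)\to V_I(y)$ for $x\le y$ in $I$. Let $G=\bigoplus_I V_I$, the sum running over all intervals $I$ of $\mathcal P$, and let $\Lambda=\operatorname{End}_{k\mathcal P}(G)$ be the algebra of endomorphisms of $G$ acting from the right (the opposite of the endomorphism ring under the usual composition of maps). Let $\operatorname{add}G$ be the class of direct summands of finite direct sums of copies of $G$ (the interval-decomposable modules). A right $\operatorname{add}G$-approximation of a module $M$ is a morphism $f\colon X\to M$ with $X\in\operatorname{add}G$ through which every morphism $Y\to M$ with $Y\in\operatorname{add}G$ factors. An interval resolution of $M$ is a sequence $\cdots\to X_2\xrightarrow{f_2}X_1\xrightarrow{f_1}X_0\xrightarrow{f_0}M$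 in which $f_0$ is a right $\operatorname{add}G$-approximation of $M$ and $f_i$ is a right $\operatorname{add}G$-approximation of $\ker f_{i-1}$ for each $i\ge1$. The interval resolution dimension of $M$ is the least $n\geq 0$ such that $M$ has an interval resolution with $X_i=0$ for all $i>n$ (and $\infty$ if there is none). The interval resolution global dimension of $k\mathcal P$ is the supremum of the interval resolution dimensions of all finitely generated left $k\mathcal P$-modules. Then: 1. the (left) global dimension of $\Lambda$ is finite; 2. the interval resolution global dimension of $k\mathcal P$ is finite; 3. every finitely generated projective left $k\mathcal P$-module lies in $\operatorname{add}G$. In particular, the set of interval modules satisfies both conditions required for defining a homological invariant of $k\mathcal P$: all indecomposable projectives are among the modules in $\operatorname{add} G$, and every finitely generated module has finite interval resolution dimension. -/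

import Mathlib

open CategoryTheory

universe u v w

noncomputable section

/-! ### Finite posets, intervals and the incidence algebra -/

/-- An interval of a poset `P`: a subset which is connected (as an induced subgraph of the Hasse
diagram, in particular non-empty) and convex. -/
structure PosetInterval (P : Type v) [PartialOrder P] where
  /-- The underlying subset. -/
  carrier : Set P
  connected : ((SimpleGraph.hasse P).induce carrier).Connected
  convex : ∀ p ∈ carrier, ∀ q ∈ carrier, Set.Icc p q ⊆ carrier

/-- The incidence algebra `kP` of `P`, with the convention that the product is
`(f * g) [x, y] = ∑ x ≤ z ≤ y, g [x, z] * f [z, y]`, i.e. the opposite of Mathlib's convention.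
Its left modules are the persistence modules (covariant functors from `P` to vector spaces). -/
abbrev PosetAlgebra (k : Type u) (P : Type v) [Field k] [PartialOrder P]
    [LocallyFiniteOrder P] : Type (max u v) :=
  (IncidenceAlgebra k P)ᵐᵒᵖ

/-! ### Interval modules -/

/-- The interval module `V_I`, with one copy of `k` at each point of `I`, zero elsewhere. -/
def IntervalModule (k : Type u) {P : Type v} [Field k] [PartialOrder P] (I : PosetInterval P) :
    Type (max u v) :=
  I.carrier → k

section IntervalModule

variable {k : Type u} {P : Type v} [Field k] [PartialOrder P]

instance (I : PosetInterval P) : AddCommGroup (IntervalModule k I) :=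
  inferInstanceAs (AddCommGroup (I.carrier → k))

instance [Finite P] (I : PosetInterval P) : Fintype I.carrier :=
  Fintype.ofFinite _

variable [Finite P] [LocallyFiniteOrder P]

/-- The action of `kP` on `V_I`: for `x ≤ y` in `I` the structure map from the copy of `k` at `x`
to the copy of `k` at `y` is the identity. -/
instance (I : PosetInterval P) : SMul (PosetAlgebra k P) (IntervalModule k I) where
  smul a v := fun y => ∑ x : I.carrier, a.unop x.1 y.1 * v x

theorem IntervalModule.smul_apply (I : PosetInterval P) (a : PosetAlgebra k P)
    (v : IntervalModule k I) (y : I.carrier) :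
    (a • v) y = ∑ x : I.carrier, a.unop x.1 y.1 * v x := rfl

theorem IntervalModule.mul_smul_aux (I : PosetInterval P) (a b : PosetAlgebra k P)
    (v : IntervalModule k I) : (a * b) • v = a • b • v := by
  classical
  funext y
  simp only [IntervalModule.smul_apply, MulOpposite.unop_mul, IncidenceAlgebra.mul_apply,
    Finset.mul_sum]
  rw [Finset.sum_comm]
  refine Finset.sum_congr rfl fun x _ => ?_
  rw [Finset.sum_mul]
  have hsub : ∀ z ∈ Finset.Icc x.1 y.1, z ∈ I.carrier := fun z hz =>
    I.convex _ x.2 _ y.2 (by simpa using hz)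
  symm
  refine Finset.sum_bij_ne_zero (fun z _ _ => z.1) ?_ ?_ ?_ ?_
  · intro z _ hz
    rw [Finset.mem_Icc]
    refine ⟨?_, ?_⟩
    · by_contra h
      exact hz (by rw [IncidenceAlgebra.apply_eq_zero_of_not_le h]; ring)
    · by_contra h
      exact hz (by rw [IncidenceAlgebra.apply_eq_zero_of_not_le h]; ring)
  · intro z _ _ z' _ _ h
    exact Subtype.ext h
  · intro z hz hne
    exact ⟨⟨z, hsub z hz⟩, Finset.mem_univ _, fun h => hne (by rw [← h]; ring), rfl⟩
  · intro z _ _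
    ring

instance [DecidableEq P] (I : PosetInterval P) :
    Module (PosetAlgebra k P) (IntervalModule k I) where
  one_smul v := by
    funext y
    rw [IntervalModule.smul_apply, Finset.sum_eq_single y]
    · simp
    · intro x _ hx
      have : x.1 ≠ y.1 := fun h => hx (Subtype.ext h)
      simp [this]
    · intro h
      exact absurd (Finset.mem_univ _) h
  mul_smul a b v := IntervalModule.mul_smul_aux I a b v
  smul_zero a := by
    funext y
    rw [IntervalModule.smul_apply]
    exact Finset.sum_eq_zero fun x _ => mul_zero _
  smul_add a v w := by
    funext y
    change _ = (a • v) y + (a • w) y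
    simp only [IntervalModule.smul_apply]
    rw [← Finset.sum_add_distrib]
    exact Finset.sum_congr rfl fun x _ => mul_add _ _ _
  add_smul a b v := by
    funext y
    change _ = (a • v) y + (b • v) y
    simp only [IntervalModule.smul_apply]
    rw [← Finset.sum_add_distrib]
    exact Finset.sum_congr rfl fun x _ => add_mul _ _ _
  zero_smul v := by
    funext y
    rw [IntervalModule.smul_apply]
    exact Finset.sum_eq_zero fun x _ => zero_mul _

end IntervalModule

/-- The module `G`, the direct sum of the interval modules `V_I` over all intervals `I` of `P`. -/
abbrev IntervalGenerator (k : Type u) (P : Type v) [Field k] [PartialOrder P] :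
    Type (max u v) :=
  DirectSum (PosetInterval P) fun I => IntervalModule k I

/-! ### Relative homological algebra with respect to `add G` -/

section Relative

variable {A : Type u} [Ring A] (G : Type w) [AddCommGroup G] [Module A G]

/-- `X` belongs to `add G`: it is a direct summand of a finite direct sum of copies of `G`. -/
def InAdd (X : Type w) [AddCommGroup X] [Module A X] : Prop :=
  ∃ (n : ℕ) (i : X →ₗ[A] (Fin n → G)) (p : (Fin n → G) →ₗ[A] X), p ∘ₗ i = LinearMap.id

/-- `f : X → M` is a right `add G`-approximation of `M`: `X` is in `add G` and every morphism to `M`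
from a module in `add G` factors through `f`. -/
def IsRightApproximation {X M : Type w} [AddCommGroup X] [Module A X] [AddCommGroup M]
    [Module A M] (f : X →ₗ[A] M) : Prop :=
  InAdd (A := A) G X ∧
    ∀ (Y : Type w) [AddCommGroup Y] [Module A Y], InAdd (A := A) G Y →
      ∀ g : Y →ₗ[A] M, ∃ h : Y →ₗ[A] X, g = f ∘ₗ h

/-- An `add G`-resolution `⋯ → X₂ → X₁ → X₀ → M` of `M`: the map `X₀ → M` is a right
`add G`-approximation of `M`, and each further map is a right `add G`-approximation of the kernel of
the preceding one. -/
structure AddResolution (M : Type w) [AddCommGroup M] [Module A M] where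
  /-- The terms of the resolution. -/
  X : ℕ → ModuleCat.{w} A
  /-- The augmentation `X₀ → M`. -/
  aug : X 0 →ₗ[A] M
  /-- The differentials `X (i + 1) → X i`. -/
  d : ∀ i, X (i + 1) →ₗ[A] X i
  aug_d : ∀ x, d 0 x ∈ LinearMap.ker aug
  d_d : ∀ i x, d (i + 1) x ∈ LinearMap.ker (d i)
  approx_aug : IsRightApproximation G aug
  approx_d_zero : IsRightApproximation G ((d 0).codRestrict (LinearMap.ker aug) aug_d)
  approx_d_succ : ∀ i,
    IsRightApproximation G ((d (i + 1)).codRestrict (LinearMap.ker (d i)) (d_d i))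

/-- The `add G`-resolution dimension of `M` is at most `n`: there is an `add G`-resolution of the form
`0 → Xₙ → ⋯ → X₁ → X₀ → M`. -/
def ResolutionDimensionLE (M : Type w) [AddCommGroup M] [Module A M] (n : ℕ) : Prop :=
  ∃ J : AddResolution (A := A) G M, ∀ i, n < i → Subsingleton (J.X i)

/-- The `add G`-resolution dimension of `M` (`⊤` if there is no resolution of finite length). -/
def resolutionDimension (M : Type w) [AddCommGroup M] [Module A M] : ℕ∞ :=
  ⨅ (n : ℕ) (_ : ResolutionDimensionLE (A := A) G M n), (n : ℕ∞)

variable (A) in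
/-- The `add G`-resolution global dimension of `A`: the supremum of the `add G`-resolution dimensions
of the finitely generated left `A`-modules. -/
def resolutionGlobalDimension : ℕ∞ :=
  ⨆ (M : ModuleCat.{w} A) (_ : Module.Finite A M), resolutionDimension (A := A) G M

end Relative

/-- The (left) global dimension of a ring: the supremum of the projective dimensions of all left
modules. -/
def globalDimension (R : Type u) [Ring R] : WithBot ℕ∞ :=
  ⨆ M : ModuleCat.{u} R, projectiveDimension M

/-- The interval resolution global dimension of the incidence algebra `kP`. -/
def intervalResolutionGlobalDimension (k : Type u) (P : Type v) [Field k] [PartialOrder P]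
    [Finite P] [DecidableEq P] [LocallyFiniteOrder P] : ℕ∞ :=
  resolutionGlobalDimension (PosetAlgebra k P) (IntervalGenerator k P)

/-- The algebra `Λ = End(G)` of endomorphisms of `G` acting from the right, i.e. the opposite of the
endomorphism ring under the usual composition of maps. -/
abbrev IntervalEndAlgebra (k : Type u) (P : Type v) [Field k] [PartialOrder P]
    [Finite P] [DecidableEq P] [LocallyFiniteOrder P] : Type (max u v) :=
  (Module.End (PosetAlgebra k P) (IntervalGenerator k P))ᵐᵒᵖ

end

/-! The core is the finiteness of the global dimension of `Λ`; it comes from a stratification of `Λ`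
by the idempotents `e_I` of the summands `V_I`.

Three facts about intervals drive it. Connectedness forces `End V_I = k`, so `e_I Λ e_I` is `k e_I`.
The trace in `V_I` of a family of interval modules `V_J` is supported on an upward closed subset of
`I`, hence is the direct sum of the `V_K` over the components `K` of that subset. Call a set `C` of
intervals trace-closed if it contains every interval `K` such that `V_K` is a sum of images of
`V_J`, `J ∈ C`. For trace-closed `C` the components above lie in `C`, so the morphisms `G → V_I`
factoring through sums of the `V_J` form a projective left `Λ`-module `Hom(G, ⨁ V_K)`.

Let `C` and `D = C \ {I}` be trace-closed, and let `N` be killed by all `e_J`, `J ∈ D`. Cover the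
part of `N` generated by `e_I N` by copies of `Λ e_I`, one for each element of a `k`-basis of `e_I
N`. The kernel contains the same number of copies of the projective trace submodule, with a quotient
killed by all `e_J`, `J ∈ C`; so is the cokernel. Passing from `C` to `D` thus costs one in
projective dimension (`hasProjectiveDimensionLE_succ_of_trace`, `hasProjectiveDimensionLE_succ`).
Such an `I` always exists (`TraceClosed.exists_diff_singleton`); removing all intervals one at a
time goes from the zero module to all modules.

As `kP` is the sum of the `V_I` with `I` a principal up-set, it is a summand of `G`, which gives the
claim on projectives. For the resolutions, `Hom(G, -)` turns an `add G`-resolution into a projective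
resolution over `Λ`, and modules with projective image lie in `add G`. -/

/-! ### Projective dimension in short exact sequences of modules -/

section ProjectiveDimension

variable {R : Type w} [Ring R]

theorem hasProjectiveDimensionLE_zero_of_projective {M : Type w} [AddCommGroup M] [Module R M]
    (h : Module.Projective R M) : HasProjectiveDimensionLE (ModuleCat.of R M) 0 :=
  (projective_iff_hasProjectiveDimensionLE_zero _).1 ((IsProjective.iff_projective M).1 h)

theorem hasProjectiveDimensionLE_of_projective {M : Type w} [AddCommGroup M] [Module R M]
    (h : Module.Projective R M) (n : ℕ) : HasProjectiveDimensionLE (ModuleCat.of R M) n := by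
  have := hasProjectiveDimensionLE_zero_of_projective h
  exact hasProjectiveDimensionLT_of_ge _ 1 _ (by lia)

theorem projective_of_hasProjectiveDimensionLE_zero {M : Type w} [AddCommGroup M] [Module R M]
    (h : HasProjectiveDimensionLE (ModuleCat.of R M) 0) : Module.Projective R M :=
  (IsProjective.iff_projective M).2 ((projective_iff_hasProjectiveDimensionLE_zero _).2 h)

theorem hasProjectiveDimensionLE_zero_of_subsingleton (M : Type w) [AddCommGroup M] [Module R M]
    [Subsingleton M] : HasProjectiveDimensionLE (ModuleCat.of R M) 0 :=
  hasProjectiveDimensionLE_zero_of_projective inferInstance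

/-- The short complex `N → M → M / N`. -/
abbrev Submodule.quotientShortComplex {M : Type w} [AddCommGroup M] [Module R M]
    (N : Submodule R M) : ShortComplex (ModuleCat.{w} R) :=
  ModuleCat.shortComplexOfCompEqZero N.subtype N.mkQ (by ext; simp)

theorem Submodule.quotientShortComplex_shortExact {M : Type w} [AddCommGroup M] [Module R M]
    (N : Submodule R M) : N.quotientShortComplex.ShortExact :=
  ModuleCat.shortComplex_shortExact _ (LinearMap.exact_subtype_mkQ N) N.injective_subtype
    N.mkQ_surjective

theorem LinearEquiv.hasProjectiveDimensionLE {M N : Type w} [AddCommGroup M] [Module R M]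
    [AddCommGroup N] [Module R N] (e : M ≃ₗ[R] N) {n : ℕ}
    (h : HasProjectiveDimensionLE (ModuleCat.of R M) n) :
    HasProjectiveDimensionLE (ModuleCat.of R N) n :=
  hasProjectiveDimensionLT_of_iso e.toModuleIso _

theorem hasProjectiveDimensionLE_of_submodule {M : Type w} [AddCommGroup M] [Module R M]
    (N : Submodule R M) {n : ℕ} (h₁ : HasProjectiveDimensionLE (ModuleCat.of R N) n)
    (h₂ : HasProjectiveDimensionLE (ModuleCat.of R (M ⧸ N)) n) :
    HasProjectiveDimensionLE (ModuleCat.of R M) n :=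
  N.quotientShortComplex_shortExact.hasProjectiveDimensionLT_X₂ _ h₁ h₂

theorem hasProjectiveDimensionLE_of_injective {L M : Type w} [AddCommGroup L] [Module R L]
    [AddCommGroup M] [Module R M] (f : L →ₗ[R] M) (hf : Function.Injective f)
    (hL : Module.Projective R L) {n : ℕ}
    (h : HasProjectiveDimensionLE (ModuleCat.of R (M ⧸ LinearMap.range f)) n) :
    HasProjectiveDimensionLE (ModuleCat.of R M) n :=
  hasProjectiveDimensionLE_of_submodule (LinearMap.range f)
    ((LinearEquiv.ofInjective f hf).hasProjectiveDimensionLE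
      (hasProjectiveDimensionLE_of_projective hL n)) h

theorem hasProjectiveDimensionLE_succ_of_surjective {M N : Type w} [AddCommGroup M] [Module R M]
    [AddCommGroup N] [Module R N] (f : M →ₗ[R] N) (hf : Function.Surjective f)
    (hM : Module.Projective R M) {n : ℕ}
    (h : HasProjectiveDimensionLE (ModuleCat.of R (LinearMap.ker f)) n) :
    HasProjectiveDimensionLE (ModuleCat.of R N) (n + 1) := by
  have h₂ := hasProjectiveDimensionLE_of_projective hM
  exact (LinearMap.shortExact_shortComplexKer hf).hasProjectiveDimensionLT_X₃ (n + 1) h (h₂ _)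

theorem hasProjectiveDimensionLE_ker {M N : Type w} [AddCommGroup M] [Module R M]
    [AddCommGroup N] [Module R N] (f : M →ₗ[R] N) (hf : Function.Surjective f)
    (hM : Module.Projective R M) {n : ℕ}
    (h : HasProjectiveDimensionLE (ModuleCat.of R N) (n + 1)) :
    HasProjectiveDimensionLE (ModuleCat.of R (LinearMap.ker f)) n := by
  have h₂ := hasProjectiveDimensionLE_of_projective hM
  exact (LinearMap.shortExact_shortComplexKer hf).hasProjectiveDimensionLT_X₁ (n + 1) (h₂ _) h

end ProjectiveDimension

/-! ### The vector space cut out by an idempotent -/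

section FixedPart

variable {k : Type u} [Field k] {R : Type w} [Ring R] (ψ : k →ₙ+* R)
  (N : Type w) [AddCommGroup N] [Module R N]

/-- The image of the idempotent `ψ 1` on a module `N`, for a non-unital ring homomorphism
`ψ : k → R`. -/
def FixedPart : AddSubgroup N where
  carrier := {n | ψ 1 • n = n}
  zero_mem' := smul_zero _
  add_mem' {a b} ha hb := by
    rw [Set.mem_ofPred_eq] at *
    rw [smul_add, ha, hb]
  neg_mem' {a} ha := by
    rw [Set.mem_ofPred_eq] at *
    rw [smul_neg, ha]

variable {N} in
theorem smul_mem_fixedPart (c : k) (n : N) : ψ c • n ∈ FixedPart ψ N := by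
  change ψ 1 • ψ c • n = ψ c • n
  rw [← mul_smul, ← map_mul, one_mul]

instance : SMul k (FixedPart ψ N) where
  smul c n := ⟨ψ c • n.1, smul_mem_fixedPart ψ c n.1⟩

theorem FixedPart.coe_smul (c : k) (n : FixedPart ψ N) : ((c • n : FixedPart ψ N) : N) = ψ c • n.1 :=
  rfl

/-- Since `ψ` is not unital, `k` acts unitally only on the image of `ψ 1`. -/
instance : Module k (FixedPart ψ N) where
  one_smul n := Subtype.ext n.2
  mul_smul a b n := Subtype.ext (by simp only [FixedPart.coe_smul, map_mul, mul_smul])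
  smul_zero a := Subtype.ext (smul_zero _)
  smul_add a x y := Subtype.ext (smul_add _ _ _)
  add_smul a b x := Subtype.ext (by
    simp only [FixedPart.coe_smul, map_add, add_smul, AddSubgroup.coe_add])
  zero_smul x := Subtype.ext (by simp only [FixedPart.coe_smul, map_zero, zero_smul]; rfl)

end FixedPart

/-! ### Adding one idempotent to the stratification -/

section Step

variable {R : Type w} [Ring R]

theorem projective_finsupp (ι M : Type*) [AddCommGroup M] [Module R M] [Module.Projective R M] :
    Module.Projective R (ι →₀ M) := by
  classical
  exact Module.Projective.of_equiv' (finsuppLequivDFinsupp R).symm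

theorem projective_span_idempotent {e : R} (he : e * e = e) :
    Module.Projective R (Submodule.span R {e}) := by
  refine Module.Projective.of_split (Submodule.span R {e}).subtype
    ((LinearMap.toSpanSingleton R R e).codRestrict _ fun a =>
      Submodule.smul_mem _ a (Submodule.mem_span_singleton_self e)) ?_
  ext ⟨x, hx⟩
  obtain ⟨a, rfl⟩ := Submodule.mem_span_singleton.1 hx
  change (a * e) * e = a * e
  rw [mul_assoc, he]

/-- Right multiplication by `u` is an isomorphism from `R ε` to `R u`: `hεu` makes it surjective and
`hu` injective. -/
theorem projective_span_of_idempotent {ε u : R} (hε : ε * ε = ε) (hεu : ε * u = u)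
    (hu : ∀ a, a * u = 0 → a * ε = 0) : Module.Projective R (Submodule.span R {u}) := by
  have := projective_span_idempotent hε
  let f : Submodule.span R {ε} →ₗ[R] Submodule.span R {u} :=
    ((LinearMap.toSpanSingleton R R u) ∘ₗ (Submodule.span R {ε}).subtype).codRestrict _ fun a =>
      Submodule.smul_mem _ _ (Submodule.mem_span_singleton_self u)
  refine Module.Projective.of_equiv (LinearEquiv.ofBijective f ⟨?_, ?_⟩)
  · rw [injective_iff_map_eq_zero]
    rintro ⟨x, hx⟩ h
    obtain ⟨a, rfl⟩ := Submodule.mem_span_singleton.1 hx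
    have h' : (a * ε) * u = 0 := congrArg Subtype.val h
    rw [mul_assoc, hεu] at h'
    exact Subtype.ext (hu a h')
  · rintro ⟨x, hx⟩
    obtain ⟨a, rfl⟩ := Submodule.mem_span_singleton.1 hx
    refine ⟨⟨a * ε, Submodule.mem_span_singleton.2 ⟨a, rfl⟩⟩, Subtype.ext ?_⟩
    change (a * ε) * u = a * u
    rw [mul_assoc, hεu]

/-- Enlarging by one idempotent `ψ 1` the class of modules of bounded projective dimension: if all
modules killed by the idempotents in `E` and by `ψ 1` have projective dimension at most `d`, then
all modules killed by `E` have projective dimension at most `d + 1`. Here `R u` is the trace of `E`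
in `R (ψ 1)`, assumed projective. -/
theorem hasProjectiveDimensionLE_succ_of_trace {k : Type u} [Field k] (ψ : k →ₙ+* R)
    (hψ : ∀ a, ∃ c, ψ 1 * a * ψ 1 = ψ c) (E : Set R)
    {u : R} (huψ : u * ψ 1 = u) (hu : Module.Projective R (Submodule.span R {u}))
    (huE : u ∈ Submodule.span R {x | ∃ e ∈ E, ∃ a, x = e * a})
    (hE : ∀ e ∈ E, ∀ a, e * a * ψ 1 ∈ Submodule.span R {u}) {d : ℕ}
    (hd : ∀ (N : Type w) [AddCommGroup N] [Module R N], (∀ e ∈ E, ∀ n : N, e • n = 0) →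
      (∀ n : N, ψ 1 • n = 0) → HasProjectiveDimensionLE (ModuleCat.of R N) d)
    (N : Type w) [AddCommGroup N] [Module R N] (hN : ∀ e ∈ E, ∀ n : N, e • n = 0) :
    HasProjectiveDimensionLE (ModuleCat.of R N) (d + 1) := by
  classical
  have hidem : ψ 1 * ψ 1 = ψ 1 := by rw [← map_mul, one_mul]
  have hproj := projective_span_idempotent hidem
  have hun : ∀ n : N, u • n = 0 := fun n => by
    have : Submodule.span R {x | ∃ e ∈ E, ∃ a, x = e * a} ≤
        LinearMap.ker (LinearMap.toSpanSingleton R N n) := by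
      rw [Submodule.span_le]
      rintro _ ⟨e, he, a, rfl⟩
      simp [mul_smul, hN e he]
    simpa using this huE
  -- One copy of `R (ψ 1)` is used for each basis vector of `ψ 1 N`; linear independence will
  -- control the kernel of `φ`, and spanning its cokernel.
  let B := Module.Basis.ofVectorSpace k (FixedPart ψ N)
  set ι := Module.Basis.ofVectorSpaceIndex k (FixedPart ψ N)
  let φ : (ι →₀ Submodule.span R {ψ 1}) →ₗ[R] N :=
    Finsupp.lsum ℕ fun b =>
      LinearMap.toSpanSingleton R N (B b : N) ∘ₗ (Submodule.span R {ψ 1}).subtype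
  have hφ : ∀ f, φ f = f.sum fun b x => (x : R) • (B b : N) := fun f => by
    simp only [φ, Finsupp.lsum_apply]
    rfl
  have hle : Submodule.span R {u} ≤ Submodule.span R {ψ 1} := by
    rw [Submodule.span_singleton_le_iff_mem]
    exact Submodule.mem_span_singleton.2 ⟨u, huψ⟩
  have hmul : ∀ x : Submodule.span R {ψ 1}, (x : R) * ψ 1 = x := fun ⟨x, hx⟩ => by
    obtain ⟨a, rfl⟩ := Submodule.mem_span_singleton.1 hx
    simp [mul_assoc, hidem]
  -- As `ψ 1 R ψ 1` consists of scalars, `ψ 1 • φ f` is an honest `k`-linear combination of the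
  -- basis.
  have hsmul : ∀ (f : ι →₀ Submodule.span R {ψ 1}) (g : ι →₀ k),
      (∀ b, ψ 1 * (f b : R) = ψ (g b)) → ψ 1 • φ f =
        ((Finsupp.linearCombination k B g : FixedPart ψ N) : N) := fun f g hg => by
    rw [hφ, Finsupp.smul_sum, Finsupp.linearCombination_apply,
      Finsupp.sum_of_support_subset f (s := f.support ∪ g.support) Finset.subset_union_left _
        (by simp),
      Finsupp.sum_of_support_subset g (s := f.support ∪ g.support) Finset.subset_union_right _
        (by simp), AddSubgroup.val_finsetSum]
    refine Finset.sum_congr rfl fun b _ => ?_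
    rw [FixedPart.coe_smul, ← hg, mul_smul]
  let γ : (ι →₀ Submodule.span R {u}) →ₗ[R] LinearMap.ker φ :=
    (Finsupp.mapRange.linearMap (Submodule.inclusion hle)).codRestrict _ fun f => by
      rw [LinearMap.mem_ker, hφ, Finsupp.mapRange.linearMap_apply,
        Finsupp.sum_mapRange_index (by simp)]
      refine Finset.sum_eq_zero fun b _ => ?_
      obtain ⟨a, ha⟩ := Submodule.mem_span_singleton.1 (f b).2
      simp [← ha, mul_smul, hun]
  have hγ : Function.Injective γ := by
    intro f g h
    have h' := congrArg Subtype.val h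
    exact Finsupp.mapRange_injective _ (map_zero _) (Submodule.inclusion_injective hle) h'
  have hγr : ∀ x : LinearMap.ker φ, (∀ b, ((x.1 b : _) : R) ∈ Submodule.span R {u}) →
      x ∈ LinearMap.range γ := fun x hx => by
    refine ⟨⟨x.1.support, fun b => ⟨x.1 b, hx b⟩, fun b => ?_⟩, ?_⟩
    · simp [Submodule.mk_eq_zero]
    · refine Subtype.ext (Finsupp.ext fun b => Subtype.ext ?_)
      rfl
  -- The kernel is an extension of a quotient killed by `E` and `ψ 1` by the projective image of
  -- `γ`.
  have hker : HasProjectiveDimensionLE (ModuleCat.of R (LinearMap.ker φ)) d := by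
    refine hasProjectiveDimensionLE_of_injective γ hγ (projective_finsupp _ _) (hd _ ?_ ?_)
    · intro e he n
      obtain ⟨x, rfl⟩ := Submodule.Quotient.mk_surjective _ n
      rw [← Submodule.Quotient.mk_smul, Submodule.Quotient.mk_eq_zero]
      refine hγr _ fun b => ?_
      have := hE e he (x.1 b)
      rwa [mul_assoc, hmul] at this
    · intro n
      obtain ⟨x, rfl⟩ := Submodule.Quotient.mk_surjective _ n
      rw [← Submodule.Quotient.mk_smul, Submodule.Quotient.mk_eq_zero]
      choose c hc using fun b => hψ (x.1 b)
      have hc' : ∀ b, ψ 1 * (x.1 b : R) = ψ (c b) := fun b => by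
        rw [← hc, mul_assoc, hmul]
      -- The chosen `c b` need not vanish where `x.1 b` does, because `ψ` need not be injective; it
      -- is reset to zero there to get finite support.
      let g : ι →₀ k := Finsupp.onFinset x.1.support
        (fun b => if x.1 b = 0 then 0 else c b)
        fun b hb => Finsupp.mem_support_iff.2 fun h => hb (if_pos h)
      have hg : ∀ b, ψ 1 * (x.1 b : R) = ψ (g b) := fun b => by
        by_cases h : x.1 b = 0
        · simp [g, h]
        · simp [g, h, hc']
      have h0 := hsmul x.1 g hg
      rw [LinearMap.mem_ker.1 x.2, smul_zero] at h0
      have hg0 : g = 0 := by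
        refine linearIndependent_iff.1 B.linearIndependent g (Subtype.ext h0.symm)
      refine hγr _ fun b => ?_
      have : ψ 1 * (x.1 b : R) = 0 := by rw [hg, hg0]; simp
      change ψ 1 * (x.1 b : R) ∈ _
      rw [this]
      exact zero_mem _
  have hrange : HasProjectiveDimensionLE (ModuleCat.of R (LinearMap.range φ)) (d + 1) := by
    refine hasProjectiveDimensionLE_succ_of_surjective φ.rangeRestrict φ.surjective_rangeRestrict
      (projective_finsupp _ _) ?_
    exact LinearEquiv.hasProjectiveDimensionLE
      (LinearEquiv.ofEq _ _ (LinearMap.ker_rangeRestrict φ).symm) hker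
  refine hasProjectiveDimensionLE_of_submodule (LinearMap.range φ) hrange ?_
  have := hd (N ⧸ LinearMap.range φ) ?_ ?_
  · exact hasProjectiveDimensionLT_of_ge _ (d + 1) _ (by lia)
  · intro e he n
    obtain ⟨x, rfl⟩ := Submodule.Quotient.mk_surjective _ n
    rw [← Submodule.Quotient.mk_smul, hN e he]
    rfl
  · intro n
    obtain ⟨x, rfl⟩ := Submodule.Quotient.mk_surjective _ n
    rw [← Submodule.Quotient.mk_smul, Submodule.Quotient.mk_eq_zero]
    -- The range of `φ` contains `ψ 1 N`: expand `ψ 1 • x` in the basis.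
    let y : FixedPart ψ N := ⟨ψ 1 • x, smul_mem_fixedPart ψ 1 x⟩
    let f : ι →₀ Submodule.span R {ψ 1} := (B.repr y).mapRange
      (fun c => ⟨ψ c, Submodule.mem_span_singleton.2 ⟨ψ c, by
        rw [smul_eq_mul, ← map_mul, mul_one]⟩⟩) (by simp)
    have h := hsmul f (B.repr y) fun b => by
      change ψ 1 * ψ _ = _
      rw [← map_mul, one_mul]
    rw [B.linearCombination_repr] at h
    refine ⟨ψ 1 • f, ?_⟩
    rw [map_smul, h]

end Step

/-! ### Modules in `add G` and approximations -/

section InAdd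

variable {A : Type u} [Ring A] {G : Type w} [AddCommGroup G] [Module A G]

theorem inAdd_pi (n : ℕ) : InAdd (A := A) G (Fin n → G) :=
  ⟨n, LinearMap.id, LinearMap.id, rfl⟩

theorem InAdd.of_retract {X Y : Type w} [AddCommGroup X] [Module A X] [AddCommGroup Y]
    [Module A Y] (hY : InAdd (A := A) G Y) (i : X →ₗ[A] Y) (p : Y →ₗ[A] X)
    (h : p ∘ₗ i = LinearMap.id) : InAdd (A := A) G X := by
  obtain ⟨n, j, q, hq⟩ := hY
  refine ⟨n, j ∘ₗ i, p ∘ₗ q, LinearMap.ext fun x => ?_⟩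
  have hq' := LinearMap.congr_fun hq (i x)
  have h' := LinearMap.congr_fun h x
  simp only [LinearMap.comp_apply, LinearMap.id_apply] at hq' h' ⊢
  rw [hq', h']

theorem inAdd_of_subsingleton (X : Type w) [AddCommGroup X] [Module A X] [Subsingleton X] :
    InAdd (A := A) G X :=
  (inAdd_pi 0).of_retract 0 0 (LinearMap.ext fun _ => Subsingleton.elim _ _)

theorem InAdd.of_projective (ι : A →ₗ[A] G) (π : G →ₗ[A] A) (hπ : π ∘ₗ ι = LinearMap.id)
    {Q : Type w} [AddCommGroup Q] [Module A Q] [Module.Finite A Q] [Module.Projective A Q] :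
    InAdd (A := A) G Q := by
  obtain ⟨n, f, hf⟩ := Module.Finite.exists_fin' A Q
  obtain ⟨s, hs⟩ := Module.projective_lifting_property f LinearMap.id hf
  refine ⟨n, ι.compLeft (Fin n) ∘ₗ s, f ∘ₗ π.compLeft (Fin n), LinearMap.ext fun x => ?_⟩
  have h : (π.compLeft (Fin n)) ((ι.compLeft (Fin n)) (s x)) = s x :=
    funext fun j => LinearMap.congr_fun hπ _
  simp only [LinearMap.comp_apply, LinearMap.id_apply]
  rw [h]
  exact LinearMap.congr_fun hs x

/-- A module in `add G` is a retract of some `G ^ n`, and a map from `G ^ n` lifts one coordinate at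
a time. -/
theorem isRightApproximation_of_lift {X M : Type w} [AddCommGroup X] [Module A X] [AddCommGroup M]
    [Module A M] {f : X →ₗ[A] M} (hX : InAdd (A := A) G X)
    (hf : ∀ g : G →ₗ[A] M, ∃ h : G →ₗ[A] X, g = f ∘ₗ h) : IsRightApproximation G f := by
  refine ⟨hX, fun Y _ _ ⟨n, i, p, hip⟩ g => ?_⟩
  choose h hh using fun j : Fin n => hf (g ∘ₗ p ∘ₗ LinearMap.single A (fun _ => G) j)
  refine ⟨(∑ j, h j ∘ₗ LinearMap.proj j) ∘ₗ i, LinearMap.ext fun y => ?_⟩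
  have hy := LinearMap.congr_fun hip y
  simp only [LinearMap.comp_apply, LinearMap.id_apply] at hy
  have key : ∀ j (x : G), f (h j x) = g (p (Pi.single j x)) := fun j x =>
    (LinearMap.congr_fun (hh j) x).symm
  simp only [LinearMap.comp_apply, LinearMap.sum_apply, map_sum, LinearMap.proj_apply, key]
  rw [← map_sum, ← map_sum, Finset.univ_sum_single, hy]

theorem IsRightApproximation.lift {X M : Type w} [AddCommGroup X] [Module A X] [AddCommGroup M]
    [Module A M] {f : X →ₗ[A] M} (hf : IsRightApproximation G f) (g : G →ₗ[A] M) :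
    ∃ h : G →ₗ[A] X, g = f ∘ₗ h :=
  hf.2 G ⟨1, LinearMap.single A (fun _ => G) 0, LinearMap.proj 0, by ext; simp⟩ g

theorem IsRightApproximation.of_eq {X N : Type w} [AddCommGroup X] [Module A X] [AddCommGroup N]
    [Module A N] {K K' : Submodule A N} (h : K = K') {f : X →ₗ[A] K} {f' : X →ₗ[A] K'}
    (hf : IsRightApproximation G f) (hff' : ∀ x, (f' x : N) = f x) :
    IsRightApproximation G f' := by
  subst h
  obtain rfl : f' = f := LinearMap.ext fun x => Subtype.ext (hff' x)
  exact hf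

theorem isRightApproximation_id {M : Type w} [AddCommGroup M] [Module A M]
    (hM : InAdd (A := A) G M) : IsRightApproximation G (LinearMap.id : M →ₗ[A] M) :=
  ⟨hM, fun _ _ _ _ g => ⟨g, rfl⟩⟩

end InAdd

/-! ### The functor `Hom(G, -)` to modules over the endomorphism algebra -/

section HomFrom

variable {A : Type w} [Ring A] (G : Type w) [AddCommGroup G] [Module A G]

/-- The homomorphisms from `G` to `M`, as a left module over the opposite of `End G`. -/
def HomFrom (A : Type w) [Ring A] (G : Type w) [AddCommGroup G] [Module A G] (M : Type w)
    [AddCommGroup M] [Module A M] : Type w :=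
  G →ₗ[A] M

variable (M N : Type w) [AddCommGroup M] [Module A M] [AddCommGroup N] [Module A N]

noncomputable instance : AddCommGroup (HomFrom A G M) :=
  inferInstanceAs (AddCommGroup (G →ₗ[A] M))

instance : FunLike (HomFrom A G M) G M :=
  inferInstanceAs (FunLike (G →ₗ[A] M) G M)

noncomputable instance : Module (Module.End A G)ᵐᵒᵖ (HomFrom A G M) where
  smul a h := LinearMap.comp h a.unop
  one_smul h := LinearMap.comp_id h
  mul_smul a b h := (LinearMap.comp_assoc a.unop b.unop h).symm
  smul_zero _ := LinearMap.zero_comp _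
  smul_add _ _ _ := LinearMap.add_comp _ _ _
  add_smul _ _ _ := LinearMap.comp_add _ _ _
  zero_smul _ := LinearMap.comp_zero _

variable {G M N}

/-- Postcomposition with `f`. -/
noncomputable def HomFrom.map (f : M →ₗ[A] N) :
    HomFrom A G M →ₗ[(Module.End A G)ᵐᵒᵖ] HomFrom A G N where
  toFun h := f.comp h
  map_add' _ _ := LinearMap.comp_add _ _ _
  map_smul' _ _ := (LinearMap.comp_assoc _ _ _).symm

/-- `Hom(G, -)` preserves kernels. -/
noncomputable def HomFrom.kerMapEquiv (f : M →ₗ[A] N) :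
    LinearMap.ker (HomFrom.map (G := G) f) ≃ₗ[(Module.End A G)ᵐᵒᵖ]
      HomFrom A G (LinearMap.ker f) where
  toFun h := LinearMap.codRestrict (LinearMap.ker f) h.1 fun x => LinearMap.congr_fun h.2 x
  map_add' _ _ := rfl
  map_smul' _ _ := rfl
  invFun h := ⟨(LinearMap.ker f).subtype.comp h, LinearMap.ext fun x => (h x).2⟩
  left_inv _ := rfl
  right_inv _ := rfl

theorem HomFrom.projective_of_inAdd (hM : InAdd (A := A) G M) :
    Module.Projective (Module.End A G)ᵐᵒᵖ (HomFrom A G M) := by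
  obtain ⟨n, i, p, hip⟩ := hM
  let I : HomFrom A G M →ₗ[(Module.End A G)ᵐᵒᵖ] (Fin n → (Module.End A G)ᵐᵒᵖ) :=
    { toFun := fun h j => MulOpposite.op (LinearMap.proj j ∘ₗ i ∘ₗ h)
      map_add' := fun h h' => funext fun j => MulOpposite.unop_injective
        (LinearMap.ext fun x => by
          change i (h x + h' x) j = _
          rw [map_add]
          rfl)
      map_smul' := fun a h => rfl }
  let S : (Fin n → (Module.End A G)ᵐᵒᵖ) →ₗ[(Module.End A G)ᵐᵒᵖ] HomFrom A G M :=
    { toFun := fun r => p ∘ₗ LinearMap.pi fun j => (r j).unop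
      map_add' := fun r r' => LinearMap.ext fun x => p.map_add _ _
      map_smul' := fun a r => rfl }
  exact Module.Projective.of_split I S
    (LinearMap.ext fun h => LinearMap.ext fun x => LinearMap.congr_fun hip (h x))

/-- Full faithfulness of `Hom(G, -)` for a generator `G`, on split epimorphisms. -/
theorem exists_section_of_homFrom (ι : A →ₗ[A] G) (π : G →ₗ[A] A) (hπ : π ∘ₗ ι = LinearMap.id)
    (f : M →ₗ[A] N) (s : HomFrom A G N →ₗ[(Module.End A G)ᵐᵒᵖ] HomFrom A G M)
    (hs : HomFrom.map f ∘ₗ s = LinearMap.id) : ∃ σ : N →ₗ[A] M, f ∘ₗ σ = LinearMap.id := by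
  -- `T` embeds `N = Hom(A, N)` into `Hom(G, N)` along `π`; evaluating at `ι 1` goes back.
  let T : N → HomFrom A G N := fun x => LinearMap.toSpanSingleton A N x ∘ₗ π
  have hT : ∀ x y, T (x + y) = T x + T y := fun x y => LinearMap.ext fun g => by
    change π g • (x + y) = π g • x + π g • y
    rw [smul_add]
  have hπ' : ∀ a, π (ι a) = a := LinearMap.congr_fun hπ
  let σ : N →ₗ[A] M :=
    { toFun := fun x => s (T x) (ι 1)
      map_add' := fun x y => by
        rw [hT, map_add]
        rfl
      map_smul' := fun a x => by
        -- Right multiplication by `a` on the summand `A` extends to an endomorphism of `G`, so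
        -- `Λ`-linearity of `s` yields `A`-linearity of `σ`.
        have h : T (a • x) =
            MulOpposite.op (ι ∘ₗ LinearMap.toSpanSingleton A A a ∘ₗ π) • T x :=
          LinearMap.ext fun g => by
            change π g • a • x = π (ι (π g * a)) • x
            rw [hπ', mul_smul]
        rw [h, map_smul]
        change s (T x) (ι (π (ι 1) * a)) = a • s (T x) (ι 1)
        have e : ι a = a • ι 1 := by rw [← ι.map_smul, smul_eq_mul, mul_one]
        rw [hπ', one_mul, e]
        exact LinearMap.map_smul (s (T x) : G →ₗ[A] M) a (ι 1) }
  refine ⟨σ, LinearMap.ext fun x => ?_⟩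
  have h := LinearMap.congr_fun (LinearMap.congr_fun hs (T x)) (ι 1)
  change f (s (T x) (ι 1)) = π (ι 1) • x at h
  rw [hπ', one_smul] at h
  exact h

end HomFrom

/-! ### From projective dimension over `End G` to `add G`-resolutions -/

section Resolution

variable {A : Type w} [Ring A] {G : Type w} [AddCommGroup G] [Module A G]

/-- `Hom(G, M)` is finite-dimensional over `k`; the members of a basis, taken together, form an
approximation. -/
theorem exists_isRightApproximation_of_finite (k : Type*) [Field k] [Algebra k A]
    [Module.Finite k A] [Module.Finite A G] (M : Type w) [AddCommGroup M] [Module A M]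
    [Module.Finite A M] : ∃ (n : ℕ) (f : (Fin n → G) →ₗ[A] M), IsRightApproximation G f := by
  let _ : Module k M := Module.compHom M (algebraMap k A)
  let _ : Module k G := Module.compHom G (algebraMap k A)
  have : IsScalarTower k A M := .of_algebraMap_smul fun _ _ => rfl
  have : IsScalarTower k A G := .of_algebraMap_smul fun _ _ => rfl
  have : SMulCommClass A k M := IsScalarTower.to_smulCommClass'
  have : SMulCommClass A k G := IsScalarTower.to_smulCommClass'
  have : Module.Finite k M := Module.Finite.trans A M
  have : Module.Finite k G := Module.Finite.trans A G
  have : Module.Finite k (G →ₗ[A] M) :=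
    FiniteDimensional.of_injective (LinearMap.restrictScalarsₗ k A G M k)
      (LinearMap.restrictScalars_injective k)
  let b := Module.finBasis k (G →ₗ[A] M)
  refine ⟨_, ∑ j, b j ∘ₗ LinearMap.proj j, isRightApproximation_of_lift (inAdd_pi _) fun g =>
    ⟨LinearMap.pi fun j => b.repr g j • LinearMap.id, LinearMap.ext fun x => ?_⟩⟩
  conv_lhs => rw [← b.sum_repr g]
  simp only [LinearMap.comp_apply, LinearMap.sum_apply, LinearMap.proj_apply, LinearMap.pi_apply,
    LinearMap.smul_apply, LinearMap.id_apply]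
  refine Finset.sum_congr rfl fun j _ => ?_
  exact ((b j).map_smul (algebraMap k A (b.repr g j)) x).symm

/-- Using the identity as approximation on `add G` makes a resolution stop once a syzygy lies in
`add G`. -/
theorem exists_isRightApproximation_injective (k : Type*) [Field k] [Algebra k A]
    [Module.Finite k A] [Module.Finite A G] (M : ModuleCat.{w} A) (hM : Module.Finite A M) :
    ∃ (X : ModuleCat.{w} A) (_ : Module.Finite A X) (f : X →ₗ[A] M),
      IsRightApproximation G f ∧ (InAdd (A := A) G M → Function.Injective f) := by
  by_cases h : InAdd (A := A) G M
  · exact ⟨M, hM, LinearMap.id, isRightApproximation_id h, fun _ => Function.injective_id⟩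
  · obtain ⟨n, f, hf⟩ := exists_isRightApproximation_of_finite (A := A) (G := G) k M
    exact ⟨ModuleCat.of A (Fin n → G), inferInstanceAs (Module.Finite A (Fin n → G)), f, hf,
      fun h' => absurd h' h⟩

theorem IsRightApproximation.map_surjective {X M : Type w} [AddCommGroup X] [Module A X]
    [AddCommGroup M] [Module A M] {f : X →ₗ[A] M} (hf : IsRightApproximation G f) :
    Function.Surjective (HomFrom.map (G := G) f) := fun g => by
  obtain ⟨h, hh⟩ := hf.lift g
  exact ⟨h, hh.symm⟩

/-- An approximation of `M` splits after applying `Hom(G, -)`, hence already before, so `M` is a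
retract of some `G ^ n`. -/
theorem inAdd_of_projective_homFrom (k : Type*) [Field k] [Algebra k A]
    [Module.Finite k A] [Module.Finite A G] (ι : A →ₗ[A] G) (π : G →ₗ[A] A)
    (hπ : π ∘ₗ ι = LinearMap.id) (M : Type w) [AddCommGroup M] [Module A M] [Module.Finite A M]
    (hM : Module.Projective (Module.End A G)ᵐᵒᵖ (HomFrom A G M)) : InAdd (A := A) G M := by
  obtain ⟨n, f, hf⟩ := exists_isRightApproximation_of_finite (A := A) (G := G) k M
  obtain ⟨s, hs⟩ := Module.projective_lifting_property (HomFrom.map (G := G) f) LinearMap.id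
    hf.map_surjective
  obtain ⟨σ, hσ⟩ := exists_section_of_homFrom ι π hπ f s hs
  exact hf.1.of_retract σ f hσ

theorem resolutionDimensionLE_of_hasProjectiveDimensionLE (k : Type*) [Field k] [Algebra k A]
    [Module.Finite k A] [Module.Finite A G] (ι : A →ₗ[A] G) (π : G →ₗ[A] A)
    (hπ : π ∘ₗ ι = LinearMap.id) {d : ℕ} (M : ModuleCat.{w} A) (hM : Module.Finite A M)
    (hd : HasProjectiveDimensionLE (ModuleCat.of (Module.End A G)ᵐᵒᵖ (HomFrom A G M)) d) :
    ResolutionDimensionLE (A := A) G M d := by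
  have : IsNoetherianRing A := isNoetherian_of_tower k inferInstance
  choose X hX f hf hinj using exists_isRightApproximation_injective (A := A) (G := G) k
  let syz : ℕ → {M : ModuleCat.{w} A // Module.Finite A M} := fun n =>
    Nat.rec ⟨M, hM⟩ (fun _ K => ⟨ModuleCat.of A (LinearMap.ker (f K.1 K.2)),
      have := hX K.1 K.2
      inferInstanceAs (Module.Finite A (LinearMap.ker (f K.1 K.2)))⟩) n
  let F : ∀ n, X (syz n).1 (syz n).2 →ₗ[A] (syz n).1 := fun n => f (syz n).1 (syz n).2
  have hF : ∀ n, IsRightApproximation G (F n) := fun n => hf _ _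
  let δ : ∀ n, X (syz (n + 1)).1 (syz (n + 1)).2 →ₗ[A] X (syz n).1 (syz n).2 := fun n =>
    (LinearMap.ker (F n)).subtype ∘ₗ F (n + 1)
  have hker : ∀ n, LinearMap.ker (F (n + 1)) = LinearMap.ker (δ n) := fun n =>
    ((F (n + 1)).ker_comp_of_ker_eq_bot (LinearMap.ker (F n)).ker_subtype).symm
  -- Dimension shifting: each syzygy lowers the projective dimension of `Hom(G, -)` by one, reaching
  -- a projective at step `d`.
  have hpd : ∀ i n, i + n = d → HasProjectiveDimensionLE
      (ModuleCat.of (Module.End A G)ᵐᵒᵖ (HomFrom A G (syz i).1)) n := by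
    intro i
    induction i with
    | zero =>
      rintro n rfl
      rw [zero_add] at hd
      exact hd
    | succ i ih =>
      intro n hn
      have := ih (n + 1) (by lia)
      exact (HomFrom.kerMapEquiv (F i)).hasProjectiveDimensionLE
        (hasProjectiveDimensionLE_ker _ (hF i).map_surjective
          (HomFrom.projective_of_inAdd (hF i).1) this)
  have hadd : InAdd (A := A) G (syz d).1 := by
    have := (syz d).2
    exact inAdd_of_projective_homFrom k ι π hπ _
      (projective_of_hasProjectiveDimensionLE_zero (hpd d 0 rfl))
  -- A syzygy in `add G` has an injective approximation, so the next syzygy is zero, and zero is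
  -- again in `add G`.
  have hsub : ∀ j, InAdd (A := A) G (syz j).1 → Subsingleton (syz (j + 1)).1 := fun j hj =>
    (Submodule.subsingleton_iff_eq_bot).2 (LinearMap.ker_eq_bot.2 (hinj _ _ hj))
  have hsyz : ∀ j, Subsingleton (syz (d + 1 + j)).1 := by
    intro j
    induction j with
    | zero => exact hsub d hadd
    | succ j ih => exact hsub (d + 1 + j) (inAdd_of_subsingleton _)
  refine ⟨{ X := fun n => X (syz n).1 (syz n).2, aug := F 0, d := δ, aug_d := fun x => (F 1 x).2,
            d_d := fun i x => ?_, approx_aug := hF 0, approx_d_zero := hF 1,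
            approx_d_succ := fun i => ?_ }, fun i hi => ?_⟩
  · rw [← hker]
    exact (F (i + 2) x).2
  · exact (hF (i + 2)).of_eq (hker i) fun x => rfl
  · obtain ⟨j, rfl⟩ := Nat.exists_eq_add_of_le hi
    have := hsyz j
    exact (hinj _ _ (inAdd_of_subsingleton _)).subsingleton

theorem resolutionGlobalDimension_le (k : Type*) [Field k] [Algebra k A]
    [Module.Finite k A] [Module.Finite A G] (ι : A →ₗ[A] G) (π : G →ₗ[A] A)
    (hπ : π ∘ₗ ι = LinearMap.id) {d : ℕ}
    (hd : ∀ N : ModuleCat.{w} (Module.End A G)ᵐᵒᵖ, HasProjectiveDimensionLE N d) :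
    resolutionGlobalDimension A G ≤ d :=
  iSup₂_le fun M hM => iInf₂_le d
    (resolutionDimensionLE_of_hasProjectiveDimensionLE k ι π hπ M hM (hd _))

end Resolution

/-! ### Components, supports of homomorphisms and trace-closed sets -/

section Combinatorics

variable {P : Type v} [PartialOrder P]

theorem PosetInterval.carrier_injective :
    Function.Injective (PosetInterval.carrier : PosetInterval P → Set P) := by
  rintro ⟨s, _, _⟩ ⟨t, _, _⟩ h
  simpa using h

instance [Finite P] : Finite (PosetInterval P) :=
  Finite.of_injective _ PosetInterval.carrier_injective

theorem PosetInterval.induction (I : PosetInterval P) {p : P → Prop} {x : P}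
    (hx : x ∈ I.carrier) (hp : p x)
    (h : ∀ y ∈ I.carrier, ∀ z ∈ I.carrier, y ≤ z ∨ z ≤ y → p y → p z) :
    ∀ z ∈ I.carrier, p z := by
  intro z hz
  have hr := (SimpleGraph.reachable_iff_reflTransGen _ _).1
    (I.connected.preconnected ⟨x, hx⟩ ⟨z, hz⟩)
  have key : ∀ w : I.carrier, Relation.ReflTransGen
      ((SimpleGraph.hasse P).induce I.carrier).Adj ⟨x, hx⟩ w → p w := by
    intro w hw
    induction hw with
    | refl => exact hp
    | tail _ hbc ih =>
      refine h _ (Subtype.prop _) _ (Subtype.prop _) ?_ ih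
      rcases hbc with hbc | hbc
      · exact Or.inl hbc.le
      · exact Or.inr hbc.le
  exact key _ hr

/-- A chain of covers from `a` to `b` stays in `T` by convexity. -/
theorem reachable_hasse_induce_of_le [LocallyFiniteOrder P] {T : Set P}
    (hT : ∀ p ∈ T, ∀ q ∈ T, Set.Icc p q ⊆ T) {a b : P} (hab : a ≤ b) (ha : a ∈ T) (hb : b ∈ T) :
    ((SimpleGraph.hasse P).induce T).Reachable ⟨a, ha⟩ ⟨b, hb⟩ := by
  have h := le_iff_reflTransGen_covBy.1 hab
  clear hab
  induction h with
  | refl => exact SimpleGraph.Reachable.refl _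
  | @tail c d hac hcd ih =>
    have hc : c ∈ T := hT a ha d hb ⟨le_iff_reflTransGen_covBy.2 hac, hcd.le⟩
    refine (ih hc).trans (SimpleGraph.Adj.reachable ?_)
    exact Or.inl hcd

/-- `K` is a connected component of `T`. -/
structure PosetInterval.IsComponent (K : PosetInterval P) (T : Set P) : Prop where
  subset : K.carrier ⊆ T
  closed : ∀ y ∈ K.carrier, ∀ z ∈ T, y ≤ z ∨ z ≤ y → z ∈ K.carrier

theorem exists_isComponent [LocallyFiniteOrder P] {T : Set P}
    (hT : ∀ p ∈ T, ∀ q ∈ T, Set.Icc p q ⊆ T) {x : P} (hx : x ∈ T) :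
    ∃ K : PosetInterval P, x ∈ K.carrier ∧ K.IsComponent T := by
  let g := (SimpleGraph.hasse P).induce T
  let s : Set P := {z | ∃ hz : z ∈ T, g.Reachable ⟨x, hx⟩ ⟨z, hz⟩}
  have hxs : x ∈ s := ⟨hx, SimpleGraph.Reachable.refl _⟩
  have hclosed : ∀ y ∈ s, ∀ z ∈ T, y ≤ z ∨ z ≤ y → z ∈ s := by
    rintro y ⟨hy, hxy⟩ z hz (h | h)
    · exact ⟨hz, hxy.trans (reachable_hasse_induce_of_le hT h hy hz)⟩
    · exact ⟨hz, hxy.trans (reachable_hasse_induce_of_le hT h hz hy).symm⟩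
  refine ⟨⟨s, ?_, ?_⟩, hxs, fun z hz => hz.1, hclosed⟩
  · rw [SimpleGraph.connected_iff_exists_forall_reachable]
    refine ⟨⟨x, hxs⟩, ?_⟩
    have key : ∀ w : T, Relation.ReflTransGen g.Adj ⟨x, hx⟩ w → ∃ hw : w.1 ∈ s,
        ((SimpleGraph.hasse P).induce s).Reachable ⟨x, hxs⟩ ⟨w.1, hw⟩ := by
      intro w hw
      induction hw with
      | refl => exact ⟨hxs, SimpleGraph.Reachable.refl _⟩
      | @tail b c hb hbc ih =>
        obtain ⟨hbs, hr⟩ := ih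
        have hcs : c.1 ∈ s := ⟨c.2, (SimpleGraph.reachable_iff_reflTransGen _ _).2 (hb.tail hbc)⟩
        refine ⟨hcs, hr.trans (SimpleGraph.Adj.reachable ?_)⟩
        exact hbc
    rintro ⟨z, hz, hr⟩
    exact (key ⟨z, hz⟩ ((SimpleGraph.reachable_iff_reflTransGen _ _).1 hr)).2
  · intro p hp q hq z hz
    exact hclosed p hp z (hT p hp.1 q hq.1 hz) (Or.inl hz.1)

theorem PosetInterval.IsComponent.eq {K L : PosetInterval P} {T : Set P} (hK : K.IsComponent T)
    (hL : L.IsComponent T) {x : P} (hxK : x ∈ K.carrier) (hxL : x ∈ L.carrier) : K = L :=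
  PosetInterval.carrier_injective (Set.Subset.antisymm
    (K.induction hxK hxL fun y _ z hz hyz h => hL.closed y h z (hK.subset hz) hyz)
    (L.induction hxL hxK fun y _ z hz hyz h => hK.closed y h z (hL.subset hz) hyz))

/-- There is a homomorphism from the interval module of `J` to that of `I` which is nonzero at
`x`. -/
def PosetInterval.MapsAt (x : P) (J I : PosetInterval P) : Prop :=
  ∃ S : Set P, x ∈ S ∧ S ⊆ J.carrier ∧ S ⊆ I.carrier ∧
    (∀ s ∈ S, ∀ y ∈ I.carrier, s ≤ y → y ∈ S) ∧ (∀ s ∈ S, ∀ y ∈ J.carrier, y ≤ s → y ∈ S)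

/-- The composite is supported on the intersection of the two supports. -/
theorem PosetInterval.MapsAt.trans {x : P} {J I K : PosetInterval P} (h : MapsAt x J I)
    (h' : MapsAt x I K) : MapsAt x J K := by
  obtain ⟨S, hxS, hSJ, hSI, hup, hdown⟩ := h
  obtain ⟨S', hxS', hSI', hSK', hup', hdown'⟩ := h'
  refine ⟨S ∩ S', ⟨hxS, hxS'⟩, fun y hy => hSJ hy.1, fun y hy => hSK' hy.2, ?_, ?_⟩
  · intro s hs y hy hsy
    have hy' := hup' s hs.2 y hy hsy
    exact ⟨hup s hs.1 y (hSI' hy') hsy, hy'⟩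
  · intro s hs y hy hys
    have hy' := hdown s hs.1 y hy hys
    exact ⟨hy', hdown' s hs.2 y (hSI hy') hys⟩

/-- Along any comparability in `I`, membership in both supports propagates: upwards first in `S`,
then in `S'`, and downwards in the reverse order. Connectedness of `I` does the rest. -/
theorem PosetInterval.MapsAt.subset {x : P} {J I : PosetInterval P} (h : MapsAt x J I)
    (h' : MapsAt x I J) : I.carrier ⊆ J.carrier := by
  obtain ⟨S, hxS, hSJ, hSI, hup, hdown⟩ := h
  obtain ⟨S', hxS', hSI', hSJ', hup', hdown'⟩ := h'
  have key : ∀ z ∈ I.carrier, z ∈ S ∧ z ∈ S' := by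
    refine I.induction (hSI hxS) ⟨hxS, hxS'⟩ ?_
    rintro y - z hz (hyz | hyz) ⟨hy, hy'⟩
    · have := hup y hy z hz hyz
      exact ⟨this, hup' y hy' z (hSJ this) hyz⟩
    · have := hdown' y hy' z hz hyz
      exact ⟨hdown y hy z (hSJ' this) hyz, this⟩
  exact fun z hz => hSJ (key z hz).1

theorem PosetInterval.MapsAt.antisymm {x : P} {J I : PosetInterval P} (h : MapsAt x J I)
    (h' : MapsAt x I J) : J = I :=
  PosetInterval.carrier_injective (Set.Subset.antisymm (h'.subset h) (h.subset h'))

/-- `C` contains every interval whose interval module is a sum of images of interval modules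
of members of `C`. -/
def TraceClosed (C : Set (PosetInterval P)) : Prop :=
  ∀ K : PosetInterval P, (∀ x ∈ K.carrier, ∃ J ∈ C, J.MapsAt x K) → K ∈ C

/-- The support of the trace in the interval module of `I` of the interval modules of members
of `C`. -/
def traceSupport (C : Set (PosetInterval P)) (I : PosetInterval P) : Set P :=
  {x | x ∈ I.carrier ∧ ∃ J ∈ C, J.MapsAt x I}

theorem traceSupport_upward {C : Set (PosetInterval P)} {I : PosetInterval P} {x y : P}
    (hx : x ∈ traceSupport C I) (hy : y ∈ I.carrier) (hxy : x ≤ y) : y ∈ traceSupport C I := by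
  obtain ⟨_, J, hJ, S, hxS, hSJ, hSI, hup, hdown⟩ := hx
  exact ⟨hy, J, hJ, S, hup x hxS y hy hxy, hSJ, hSI, hup, hdown⟩

theorem traceSupport_convex (C : Set (PosetInterval P)) (I : PosetInterval P) :
    ∀ p ∈ traceSupport C I, ∀ q ∈ traceSupport C I, Set.Icc p q ⊆ traceSupport C I :=
  fun p hp q hq _ hz => traceSupport_upward hp (I.convex p hp.1 q hq.1 hz) hz.1

/-- The image of a map `V_J → V_I` lies in the trace, so its support can be cut down to the
component `K` and still be the support of a map `V_J → V_K`. -/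
theorem PosetInterval.IsComponent.mem_of_traceClosed {C : Set (PosetInterval P)}
    (hC : TraceClosed C) {I K : PosetInterval P} (hK : K.IsComponent (traceSupport C I)) :
    K ∈ C := by
  refine hC K fun x hx => ?_
  obtain ⟨hxI, J, hJ, S, hxS, hSJ, hSI, hup, hdown⟩ := hK.subset hx
  have hST : S ⊆ traceSupport C I := fun y hy => ⟨hSI hy, J, hJ, S, hy, hSJ, hSI, hup, hdown⟩
  refine ⟨J, hJ, S ∩ K.carrier, ⟨hxS, hx⟩, fun y hy => hSJ hy.1, fun y hy => hy.2, ?_, ?_⟩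
  · intro s hs y hy hsy
    exact ⟨hup s hs.1 y (hK.subset hy).1 hsy, hy⟩
  · intro s hs y hy hys
    have := hdown s hs.1 y hy hys
    exact ⟨this, hK.closed s hs.2 y (hST this) (Or.inr hys)⟩

/-- Any non-empty trace-closed set of intervals remains so after removing a suitable member. -/
theorem TraceClosed.exists_diff_singleton [Finite P] {C : Set (PosetInterval P)}
    (hC : TraceClosed C) (hne : C.Nonempty) : ∃ I ∈ C, TraceClosed (C \ {I}) := by
  obtain ⟨J₀, hJ₀⟩ := hne
  obtain ⟨⟨x, hx⟩⟩ := J₀.connected.nonempty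
  -- For fixed `x`, `MapsAt x` is transitive and antisymmetric. The interval to remove is minimal
  -- among the members of `C` containing `x`: no other member maps to it nontrivially at `x`.
  let r : PosetInterval P → PosetInterval P → Prop := fun J I => J.MapsAt x I ∧ J ≠ I
  have : IsTrans _ r := ⟨fun J I K h h' => ⟨h.1.trans h'.1, by
    rintro rfl
    exact h.2 (h.1.antisymm h'.1)⟩⟩
  have : Std.Irrefl r := ⟨fun J h => h.2 rfl⟩
  obtain ⟨I, ⟨hI, hxI⟩, hmin⟩ := (Finite.wellFounded_of_trans_of_irrefl r).has_min
    {J | J ∈ C ∧ x ∈ J.carrier} ⟨J₀, hJ₀, hx⟩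
  refine ⟨I, hI, fun K hK => ⟨hC K fun y hy => ?_, ?_⟩⟩
  · obtain ⟨J, hJ, h⟩ := hK y hy
    exact ⟨J, hJ.1, h⟩
  · rintro rfl
    obtain ⟨J, hJ, h⟩ := hK x hxI
    obtain ⟨S, hxS, hSJ, -⟩ := id h
    exact hmin J ⟨hJ.1, hSJ hxS⟩ ⟨h, hJ.2⟩

/-- The principal upward closed interval. -/
def PosetInterval.upper [LocallyFiniteOrder P] (x : P) : PosetInterval P where
  carrier := Set.Ici x
  connected := by
    have hconv : ∀ p ∈ Set.Ici x, ∀ q ∈ Set.Ici x, Set.Icc p q ⊆ Set.Ici x :=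
      fun p hp q _ z hz => le_trans hp hz.1
    rw [SimpleGraph.connected_iff_exists_forall_reachable]
    exact ⟨⟨x, le_refl x⟩, fun y => reachable_hasse_induce_of_le hconv y.2 _ _⟩
  convex p hp _ _ _ hz := le_trans hp hz.1

theorem PosetInterval.upper_injective [LocallyFiniteOrder P] :
    Function.Injective (upper : P → PosetInterval P) := fun _ _ h =>
  Set.Ici_injective (congrArg PosetInterval.carrier h)

end Combinatorics

/-! ### Homomorphisms between interval modules -/

section IntervalModule

variable {k : Type u} {P : Type v} [Field k] [PartialOrder P]

namespace IntervalModule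

open Classical in
/-- The extension by zero of an element of an interval module to a function on the poset. -/
noncomputable def val {I : PosetInterval P} (v : IntervalModule k I) (x : P) : k :=
  if h : x ∈ I.carrier then v ⟨x, h⟩ else 0

/-- The element of an interval module with the given coordinates. -/
def ofFun (I : PosetInterval P) (g : P → k) : IntervalModule k I := fun x => g x.1

variable {I J K : PosetInterval P}

theorem val_of_mem (v : IntervalModule k I) {x : P} (h : x ∈ I.carrier) : val v x = v ⟨x, h⟩ :=
  dif_pos h

theorem val_of_notMem (v : IntervalModule k I) {x : P} (h : x ∉ I.carrier) : val v x = 0 :=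
  dif_neg h

theorem val_injective : Function.Injective (val : IntervalModule k I → P → k) := fun v w h =>
  funext fun x => by
    have := congrFun h x.1
    rwa [val_of_mem v x.2, val_of_mem w x.2] at this

theorem val_ofFun_of_mem (g : P → k) {x : P} (h : x ∈ I.carrier) : val (ofFun I g) x = g x :=
  val_of_mem _ h

theorem val_ofFun_of_support (g : P → k) (hg : ∀ x, g x ≠ 0 → x ∈ I.carrier) :
    val (ofFun I g) = g := funext fun x => by
  by_cases h : x ∈ I.carrier
  · exact val_ofFun_of_mem g h
  · rw [val_of_notMem _ h]
    by_contra h'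
    exact h (hg x (Ne.symm h'))

theorem val_add (v w : IntervalModule k I) (x : P) : val (v + w) x = val v x + val w x := by
  by_cases h : x ∈ I.carrier
  · simp only [val_of_mem _ h]
    rfl
  · simp only [val_of_notMem _ h, add_zero]

theorem val_zero (x : P) : val (0 : IntervalModule k I) x = 0 := by
  by_cases h : x ∈ I.carrier
  · rw [val_of_mem _ h]
    rfl
  · exact val_of_notMem _ h

theorem val_sum {ι : Type*} (s : Finset ι) (f : ι → IntervalModule k I) (x : P) :
    val (∑ i ∈ s, f i) x = ∑ i ∈ s, val (f i) x :=
  map_sum (AddMonoidHom.mk' (fun v : IntervalModule k I => val v x) fun v w => val_add v w x) f s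

variable [LocallyFiniteOrder P]

theorem val_smul_of_mem [Fintype P] (a : PosetAlgebra k P) (v : IntervalModule k I) {y : P}
    (h : y ∈ I.carrier) : val (a • v) y = ∑ x, a.unop x y * val v x := by
  rw [val_of_mem _ h, smul_apply]
  refine Fintype.sum_of_injective Subtype.val Subtype.val_injective _ _ (fun x hx => ?_)
    fun x => by rw [val_of_mem v x.2]
  rw [val_of_notMem v fun h' => hx ⟨⟨x, h'⟩, rfl⟩, mul_zero]

open Classical in
/-- The element of the incidence algebra with value `c` at `[x, y]` and zero elsewhere. -/
noncomputable def arrow {x y : P} (h : x ≤ y) (c : k) : PosetAlgebra k P :=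
  MulOpposite.op ⟨fun a b => if a = x ∧ b = y then c else 0, fun a b hab =>
    if_neg fun h' => hab (by rw [h'.1, h'.2]; exact h)⟩

theorem val_arrow_smul [Finite P] {x y : P} (h : x ≤ y) (c : k) (v : IntervalModule k I)
    (hy : y ∈ I.carrier) : val (arrow h c • v) y = c * val v x := by
  classical
  cases nonempty_fintype P
  rw [val_smul_of_mem _ _ hy, Finset.sum_eq_single x]
  · change (if x = x ∧ y = y then c else 0) * _ = _
    rw [if_pos ⟨rfl, rfl⟩]
  · intro z _ hz
    change (if z = x ∧ y = y then c else 0) * _ = _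
    rw [if_neg fun h' => hz h'.1, zero_mul]
  · simp

theorem val_arrow_smul_of_ne [Finite P] {x y z : P} (h : x ≤ y) (c : k) (v : IntervalModule k I)
    (hz : z ≠ y) : val (arrow h c • v) z = 0 := by
  classical
  cases nonempty_fintype P
  by_cases hI : z ∈ I.carrier
  · rw [val_smul_of_mem _ _ hI]
    refine Finset.sum_eq_zero fun w _ => ?_
    change (if w = x ∧ z = y then c else 0) * _ = _
    rw [if_neg fun h' => hz h'.2, zero_mul]
  · exact val_of_notMem _ hI

variable [Finite P] [DecidableEq P]

/-- The coordinates of a homomorphism of interval modules. -/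
noncomputable def coeff (f : IntervalModule k J →ₗ[PosetAlgebra k P] IntervalModule k I) (x : P) :
    k :=
  val (f (ofFun J fun _ => 1)) x

variable (f : IntervalModule k J →ₗ[PosetAlgebra k P] IntervalModule k I)

/-- The map `f` commutes with the idempotent at `x`, which sends `v` to a multiple of its value on
the constant function `1`. -/
theorem val_map (v : IntervalModule k J) (x : P) : val (f v) x = val v x * coeff f x := by
  by_cases hI : x ∈ I.carrier
  · have h : arrow (le_refl x) (1 : k) • v =
        arrow (le_refl x) (val v x) • ofFun J fun _ => (1 : k) := by
      refine val_injective (funext fun z => ?_)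
      by_cases hz : z = x
      · subst hz
        by_cases hJ : z ∈ J.carrier
        · rw [val_arrow_smul _ _ _ hJ, val_arrow_smul _ _ _ hJ, val_ofFun_of_mem _ hJ, one_mul,
            mul_one]
        · rw [val_of_notMem _ hJ, val_of_notMem _ hJ]
      · rw [val_arrow_smul_of_ne _ _ _ hz, val_arrow_smul_of_ne _ _ _ hz]
    have h' := congrArg (fun w => val (f w) x) h
    simp only [map_smul, val_arrow_smul _ _ _ hI, one_mul] at h'
    exact h'
  · rw [val_of_notMem _ hI, coeff, val_of_notMem _ hI, mul_zero]

theorem mem_of_coeff_ne_zero {x : P} (h : coeff f x ≠ 0) : x ∈ J.carrier ∧ x ∈ I.carrier := by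
  refine ⟨?_, ?_⟩
  · by_contra hJ
    have := val_map f (ofFun J fun _ => 1) x
    rw [val_of_notMem _ hJ, zero_mul] at this
    exact h this
  · by_contra hI
    exact h (val_of_notMem _ hI)

/-- Naturality of `f` along `x ≤ y`. The first factor is `1` or `0` according to whether `y` lies in
`J`. -/
theorem coeff_eq_mul {x y : P} (hxy : x ≤ y) (hx : x ∈ J.carrier) (hy : y ∈ I.carrier) :
    coeff f x = val (ofFun J fun _ => (1 : k)) y * coeff f y := by
  have h := val_map f (arrow hxy (1 : k) • ofFun J fun _ => 1) y
  rw [map_smul, val_arrow_smul _ _ _ hy, one_mul] at h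
  refine h.trans ?_
  by_cases hJ : y ∈ J.carrier
  · rw [val_arrow_smul _ _ _ hJ, val_ofFun_of_mem _ hx, val_ofFun_of_mem _ hJ, one_mul]
  · rw [val_of_notMem _ hJ, val_of_notMem _ hJ]

theorem coeff_eq {x y : P} (hxy : x ≤ y) (hx : x ∈ J.carrier) (hy : y ∈ I.carrier)
    (hyJ : y ∈ J.carrier) : coeff f x = coeff f y := by
  rw [coeff_eq_mul f hxy hx hy, val_ofFun_of_mem _ hyJ, one_mul]

theorem mapsAt_of_coeff_ne_zero {x : P} (h : coeff f x ≠ 0) : J.MapsAt x I := by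
  refine ⟨{y | coeff f y ≠ 0}, h, fun y hy => (mem_of_coeff_ne_zero f hy).1,
    fun y hy => (mem_of_coeff_ne_zero f hy).2, ?_, ?_⟩
  · intro s hs y hy hsy hy0
    have := coeff_eq_mul f hsy (mem_of_coeff_ne_zero f hs).1 hy
    rw [hy0, mul_zero] at this
    exact hs this
  · intro s hs y hy hys hy0
    have hs' := mem_of_coeff_ne_zero f hs
    rw [coeff_eq f hys hy hs'.2 hs'.1] at hy0
    exact hs hy0

/-- Coefficients agree at comparable points, and `I` is connected; this is `End V_I = k`. -/
theorem exists_coeff_eq (f : Module.End (PosetAlgebra k P) (IntervalModule k I)) :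
    ∃ c, ∀ x ∈ I.carrier, coeff f x = c := by
  obtain ⟨⟨x, hx⟩⟩ := I.connected.nonempty
  refine ⟨coeff f x, I.induction hx rfl ?_⟩
  rintro y hy z hz (h | h) e
  · rw [← e, coeff_eq f h hy hz hz]
  · rw [← e, coeff_eq f h hz hy hy]

/-- Let `f : M → V_J` be a linear map. If every point of `J` below a point of `I` and in the
support of the image of `f` lies in `I ⊆ J`, then `f` can be restricted to a map to `V_I`. -/
noncomputable def restrict {M : Type*} [AddCommGroup M] [Module (PosetAlgebra k P) M]
    (I : PosetInterval P) (f : M →ₗ[PosetAlgebra k P] IntervalModule k J)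
    (hIJ : I.carrier ⊆ J.carrier)
    (hf : ∀ m x, ∀ y ∈ I.carrier, x ≤ y → val (f m) x ≠ 0 → x ∈ I.carrier) :
    M →ₗ[PosetAlgebra k P] IntervalModule k I where
  toFun m := ofFun I (val (f m))
  map_add' m n := val_injective (funext fun x => by
    by_cases h : x ∈ I.carrier
    · rw [val_add, val_ofFun_of_mem _ h, val_ofFun_of_mem _ h, val_ofFun_of_mem _ h, map_add,
        val_add]
    · rw [val_of_notMem _ h, val_of_notMem _ h])
  map_smul' a m := val_injective (funext fun y => by
    cases nonempty_fintype P
    by_cases h : y ∈ I.carrier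
    · rw [RingHom.id_apply, val_ofFun_of_mem _ h, map_smul, val_smul_of_mem _ _ h,
        val_smul_of_mem _ _ (hIJ h)]
      refine Finset.sum_congr rfl fun x _ => ?_
      by_cases hx : x ∈ I.carrier
      · rw [val_ofFun_of_mem _ hx]
      · rw [val_of_notMem _ hx]
        by_cases hxy : x ≤ y
        · rw [not_not.1 fun h' => hx (hf m x y h hxy h')]
        · rw [IncidenceAlgebra.apply_eq_zero_of_not_le hxy, zero_mul, zero_mul]
    · rw [val_of_notMem _ h, val_of_notMem _ h])

/-- The inclusion of the interval module of an upward closed subinterval. -/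
noncomputable def inclusion (hKI : K.carrier ⊆ I.carrier)
    (hup : ∀ x ∈ K.carrier, ∀ y ∈ I.carrier, x ≤ y → y ∈ K.carrier) :
    IntervalModule k K →ₗ[PosetAlgebra k P] IntervalModule k I where
  toFun v := ofFun I (val v)
  map_add' v w := val_injective (funext fun x => by
    by_cases h : x ∈ I.carrier
    · rw [val_add, val_ofFun_of_mem _ h, val_ofFun_of_mem _ h, val_ofFun_of_mem _ h, val_add]
    · rw [val_of_notMem _ h, val_of_notMem _ h])
  map_smul' a v := val_injective (funext fun y => by
    have hval : val (ofFun I (val v)) = val v := val_ofFun_of_support _ fun x hx =>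
      hKI (not_not.1 fun h' => hx (val_of_notMem _ h'))
    cases nonempty_fintype P
    by_cases h : y ∈ I.carrier
    · rw [RingHom.id_apply, val_ofFun_of_mem _ h, val_smul_of_mem _ _ h, hval]
      by_cases hK : y ∈ K.carrier
      · rw [val_smul_of_mem _ _ hK]
      · rw [val_of_notMem _ hK]
        refine (Finset.sum_eq_zero fun x _ => ?_).symm
        by_cases hx : x ∈ K.carrier
        · rw [IncidenceAlgebra.apply_eq_zero_of_not_le (fun hxy => hK (hup x hx y h hxy)),
            zero_mul]
        · rw [val_of_notMem _ hx, mul_zero]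
    · rw [val_of_notMem _ h, val_of_notMem _ h])

theorem val_inclusion (hKI : K.carrier ⊆ I.carrier)
    (hup : ∀ x ∈ K.carrier, ∀ y ∈ I.carrier, x ≤ y → y ∈ K.carrier) (v : IntervalModule k K) :
    val (inclusion hKI hup v) = val v :=
  val_ofFun_of_support _ fun _ hx => hKI (not_not.1 fun h' => hx (val_of_notMem _ h'))

/-- Multiplication by a scalar. -/
noncomputable def scale (I : PosetInterval P) (c : k) :
    IntervalModule k I →ₗ[PosetAlgebra k P] IntervalModule k I where
  toFun v := fun x => c * v x
  map_add' v w := funext fun x => mul_add _ _ _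
  map_smul' a v := funext fun y => by
    change c * ∑ x : I.carrier, a.unop x.1 y.1 * v x =
      ∑ x : I.carrier, a.unop x.1 y.1 * (c * v x)
    rw [Finset.mul_sum]
    exact Finset.sum_congr rfl fun x _ => mul_left_comm _ _ _

theorem val_scale (c : k) (v : IntervalModule k I) (x : P) : val (scale I c v) x = c * val v x := by
  by_cases h : x ∈ I.carrier
  · rw [val_of_mem _ h, val_of_mem _ h]
    rfl
  · rw [val_of_notMem _ h, val_of_notMem _ h, mul_zero]

theorem exists_eq_scale (f : Module.End (PosetAlgebra k P) (IntervalModule k I)) :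
    ∃ c, f = scale I c := by
  obtain ⟨c, hc⟩ := exists_coeff_eq f
  refine ⟨c, LinearMap.ext fun v => val_injective (funext fun x => ?_)⟩
  rw [val_map, val_scale]
  by_cases h : x ∈ I.carrier
  · rw [hc x h, mul_comm]
  · rw [val_of_notMem _ h, zero_mul, mul_zero]

theorem scale_one : scale (k := k) I 1 = LinearMap.id :=
  LinearMap.ext fun v => funext fun x => one_mul (v x)

instance finite : Module.Finite (PosetAlgebra k P) (IntervalModule k I) := by
  classical
  cases nonempty_fintype P
  refine ⟨⟨{ofFun I fun _ => 1}, ?_⟩⟩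
  rw [Finset.coe_singleton, eq_top_iff]
  intro v _
  refine Submodule.mem_span_singleton.2 ⟨∑ x, arrow (le_refl x) (val v x), ?_⟩
  rw [Finset.sum_smul]
  refine val_injective (funext fun y => ?_)
  rw [val_sum]
  by_cases h : y ∈ I.carrier
  · rw [Finset.sum_eq_single y, val_arrow_smul _ _ _ h, val_ofFun_of_mem _ h, mul_one]
    · exact fun x _ hx => val_arrow_smul_of_ne _ _ _ hx.symm
    · simp
  · rw [val_of_notMem _ h]
    exact Finset.sum_eq_zero fun x _ => val_of_notMem _ h

end IntervalModule

end IntervalModule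

/-! ### The stratification of `Λ` by intervals -/

section IntervalGenerator

variable {k : Type u} {P : Type v} [Field k] [PartialOrder P] [Finite P] [DecidableEq P]
  [LocallyFiniteOrder P]

namespace IntervalGenerator

open IntervalModule PosetInterval

open Classical in
/-- The inclusion of an interval module as a summand. -/
noncomputable def inc (I : PosetInterval P) :
    IntervalModule k I →ₗ[PosetAlgebra k P] IntervalGenerator k P :=
  DirectSum.lof (PosetAlgebra k P) (PosetInterval P) (fun I => IntervalModule k I) I

/-- The projection onto an interval module. -/
noncomputable def pr (I : PosetInterval P) :
    IntervalGenerator k P →ₗ[PosetAlgebra k P] IntervalModule k I :=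
  DirectSum.component (PosetAlgebra k P) (PosetInterval P) (fun I => IntervalModule k I) I

theorem pr_inc (I : PosetInterval P) (v : IntervalModule k I) : pr I (inc I v) = v := by
  classical
  exact DirectSum.component.lof_self _ _ _

theorem pr_inc_of_ne {I J : PosetInterval P} (h : J ≠ I) (v : IntervalModule k J) :
    pr I (inc J v) = 0 := by
  classical
  exact (DirectSum.component.of _ _ _ _).trans (dif_neg h)

theorem ext_pr {g h : IntervalGenerator k P}
    (H : ∀ I, (pr I g : IntervalModule k I) = pr I h) : g = h :=
  DirectSum.ext_component (PosetAlgebra k P) H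

theorem pr_sum_inc (s : Finset (PosetInterval P)) (g : ∀ I : PosetInterval P, IntervalModule k I)
    (I : PosetInterval P) (hI : I ∈ s) : pr I (∑ J ∈ s, inc J (g J)) = g I := by
  rw [map_sum, Finset.sum_eq_single I, pr_inc]
  · exact fun J _ h => pr_inc_of_ne h _
  · exact fun h => absurd hI h

theorem pr_sum_inc_of_notMem (s : Finset (PosetInterval P))
    (g : ∀ I : PosetInterval P, IntervalModule k I) (I : PosetInterval P) (hI : I ∉ s) :
    pr I (∑ J ∈ s, inc J (g J)) = 0 := by
  rw [map_sum]
  refine Finset.sum_eq_zero fun J hJ => pr_inc_of_ne ?_ _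
  rintro rfl
  exact hI hJ

theorem sum_inc_pr [Fintype (PosetInterval P)] (g : IntervalGenerator k P) :
    ∑ I : PosetInterval P, inc I (pr I g) = g :=
  ext_pr fun I => pr_sum_inc Finset.univ (fun J => pr J g) I (Finset.mem_univ I)

instance finite : Module.Finite (PosetAlgebra k P) (IntervalGenerator k P) := by
  classical
  cases nonempty_fintype (PosetInterval P)
  let f : (∀ I : PosetInterval P, IntervalModule k I) →ₗ[PosetAlgebra k P] IntervalGenerator k P :=
    ∑ I, inc I ∘ₗ LinearMap.proj I
  refine Module.Finite.of_surjective f fun g => ⟨fun I => pr I g, ?_⟩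
  rw [LinearMap.sum_apply]
  exact sum_inc_pr g

/-- The scalar multiples of the projection onto a summand. -/
noncomputable def scalar (I : PosetInterval P) : k →ₙ+* IntervalEndAlgebra k P where
  toFun c := MulOpposite.op (inc I ∘ₗ scale I c ∘ₗ pr I)
  map_mul' c d := MulOpposite.unop_injective (LinearMap.ext fun g => by
    change inc I (scale I (c * d) (pr I g)) =
      inc I (scale I d (pr I (inc I (scale I c (pr I g)))))
    rw [pr_inc]
    congr 1
    refine val_injective (funext fun x => ?_)
    rw [val_scale, val_scale, val_scale]
    ring)
  map_zero' := MulOpposite.unop_injective (LinearMap.ext fun g => by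
    change inc I (scale I 0 (pr I g)) = 0
    rw [← map_zero (inc I)]
    congr 1
    refine val_injective (funext fun x => ?_)
    rw [val_scale, val_zero, zero_mul])
  map_add' c d := MulOpposite.unop_injective (LinearMap.ext fun g => by
    change inc I (scale I (c + d) (pr I g)) =
      inc I (scale I c (pr I g)) + inc I (scale I d (pr I g))
    rw [← map_add]
    congr 1
    refine val_injective (funext fun x => ?_)
    rw [val_add, val_scale, val_scale, val_scale, add_mul])

theorem scalar_one (I : PosetInterval P) :
    scalar (k := k) I 1 = MulOpposite.op (inc I ∘ₗ pr I) := by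
  change MulOpposite.op (inc I ∘ₗ scale I 1 ∘ₗ pr I) = _
  rw [scale_one]
  rfl

theorem exists_scalar_eq (I : PosetInterval P) (a : IntervalEndAlgebra k P) :
    ∃ c, scalar I 1 * a * scalar I 1 = scalar I c := by
  obtain ⟨c, hc⟩ := exists_eq_scale (pr I ∘ₗ a.unop ∘ₗ inc I)
  refine ⟨c, ?_⟩
  rw [scalar_one]
  exact congrArg (fun f => MulOpposite.op (inc I ∘ₗ f ∘ₗ pr I)) hc

theorem smul_eq_sum [Fintype (PosetInterval P)] {N : Type*} [AddCommGroup N]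
    [Module (IntervalEndAlgebra k P) N] (n : N) :
    n = ∑ I : PosetInterval P, scalar (k := k) I 1 • n := by
  rw [← Finset.sum_smul]
  have : ∑ I : PosetInterval P, scalar (k := k) I 1 = 1 :=
    MulOpposite.unop_injective (LinearMap.ext fun g => by
      rw [Finset.unop_sum, LinearMap.sum_apply]
      simp only [scalar_one]
      exact sum_inc_pr g)
  rw [this, one_smul]

open Classical in
/-- Removing from a trace-closed set `C` an interval `I` such that `C \ {I}` is trace-closed
increases by at most one the bound on the projective dimension of the modules killed by it. -/
theorem hasProjectiveDimensionLE_succ {I : PosetInterval P} {D : Set (PosetInterval P)}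
    (hD : TraceClosed D) {d : ℕ}
    (hd : ∀ (N : Type (max u v)) [AddCommGroup N] [Module (IntervalEndAlgebra k P) N],
      (∀ J ∈ D, ∀ n : N, scalar (k := k) J 1 • n = 0) → (∀ n : N, scalar (k := k) I 1 • n = 0) →
        HasProjectiveDimensionLE (ModuleCat.of (IntervalEndAlgebra k P) N) d)
    (N : Type (max u v)) [AddCommGroup N] [Module (IntervalEndAlgebra k P) N]
    (hN : ∀ J ∈ D, ∀ n : N, scalar (k := k) J 1 • n = 0) :
    HasProjectiveDimensionLE (ModuleCat.of (IntervalEndAlgebra k P) N) (d + 1) := by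
  cases nonempty_fintype (PosetInterval P)
  set T := traceSupport D I with hT
  let S : Finset (PosetInterval P) := Finset.univ.filter fun K => K.IsComponent T
  have hS : ∀ {K}, K ∈ S ↔ K.IsComponent T := fun {K} => by simp [S]
  have hsub : ∀ K : S, K.1.carrier ⊆ I.carrier := fun K x hx => ((hS.1 K.2).subset hx).1
  have hup : ∀ K : S, ∀ x ∈ K.1.carrier, ∀ y ∈ I.carrier, x ≤ y → y ∈ K.1.carrier :=
    fun K x hx y hy hxy => (hS.1 K.2).closed x hx y
      (traceSupport_upward ((hS.1 K.2).subset hx) hy hxy) (Or.inl hxy)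
  -- `p` projects `G` to the sum of the `V_K` over the components `K` of the trace support, then
  -- includes this sum in `V_I`; `q` is the idempotent of that sum.
  let p : IntervalGenerator k P →ₗ[PosetAlgebra k P] IntervalModule k I :=
    ∑ K : S, inclusion (hsub K) (hup K) ∘ₗ pr K.1
  have hp : ∀ g, p g = ∑ K : S, inclusion (hsub K) (hup K) (pr K.1 g) := fun g => by
    rw [LinearMap.sum_apply]
    rfl
  let q : IntervalGenerator k P →ₗ[PosetAlgebra k P] IntervalGenerator k P :=
    ∑ K ∈ S, inc K ∘ₗ pr K
  have hq : ∀ g, q g = ∑ K ∈ S, inc K (pr K g) := fun g => by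
    rw [LinearMap.sum_apply]
    rfl
  have hprq : ∀ K ∈ S, ∀ g, pr K (q g) = (pr K g : IntervalModule k K) := fun K hK g => by
    rw [hq]
    exact pr_sum_inc S (fun J => pr J g) K hK
  have hprq' : ∀ K ∉ S, ∀ g, pr K (q g) = (0 : IntervalModule k K) := fun K hK g => by
    rw [hq]
    exact pr_sum_inc_of_notMem S (fun J => pr J g) K hK
  -- Distinct components are disjoint, so on `K` only the summand `V_K` contributes to `p`.
  have hvalp : ∀ (K : S) g, ∀ x ∈ K.1.carrier,
      val (p g) x = val (pr K.1 g : IntervalModule k K.1) x := fun K g x hx => by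
    rw [hp, val_sum, Finset.sum_eq_single K, val_inclusion]
    · intro L _ hLK
      rw [val_inclusion]
      refine val_of_notMem _ fun hxL => hLK (Subtype.ext ?_)
      exact (hS.1 L.2).eq (hS.1 K.2) hxL hx
    · simp
  -- Products in `Λ` are composites in the opposite order, so `Λ U` consists of the maps `inc I ∘ p
  -- ∘ a`.
  let U : IntervalEndAlgebra k P := MulOpposite.op (inc I ∘ₗ p)
  let ε : IntervalEndAlgebra k P := MulOpposite.op q
  refine hasProjectiveDimensionLE_succ_of_trace (scalar (k := k) I) (exists_scalar_eq I)
    {e | ∃ J ∈ D, e = scalar (k := k) J 1} (u := U) ?_ ?_ ?_ ?_ ?_ N ?_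
  · rw [scalar_one]
    refine MulOpposite.unop_injective (LinearMap.ext fun g => ?_)
    change inc I (pr I (inc I (p g))) = inc I (p g)
    rw [pr_inc]
  · refine projective_span_of_idempotent (ε := ε) ?_ ?_ ?_
    · refine MulOpposite.unop_injective (LinearMap.ext fun g => ?_)
      change q (q g) = q g
      refine ext_pr fun K => ?_
      by_cases hK : K ∈ S
      · exact hprq K hK _
      · rw [hprq' K hK, hprq' K hK]
    · refine MulOpposite.unop_injective (LinearMap.ext fun g => ?_)
      change inc I (p (q g)) = inc I (p g)
      rw [hp, hp]
      simp only [hprq _ (Subtype.prop _)]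
    -- By `hvalp`, `p` is injective on the image of `q`.
    · intro a ha
      refine MulOpposite.unop_injective (LinearMap.ext fun g => ?_)
      change q (a.unop g) = 0
      have h0 : inc I (p (a.unop g)) = 0 :=
        LinearMap.congr_fun (congrArg MulOpposite.unop ha) g
      have h1 : p (a.unop g) = 0 := by
        rw [← pr_inc I (p (a.unop g)), h0, map_zero]
      rw [hq]
      refine Finset.sum_eq_zero fun K hK => ?_
      have h2 : (pr K (a.unop g) : IntervalModule k K) = 0 := by
        refine val_injective (funext fun x => ?_)
        rw [val_zero]
        by_cases hx : x ∈ K.carrier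
        · rw [← hvalp ⟨K, hK⟩ _ x hx, h1, val_zero]
        · exact val_of_notMem _ hx
      rw [h2, map_zero]
  -- `U` factors through the `V_K`, whose indices are in `D` by trace-closedness.
  · have hU : U = ∑ K : S, scalar (k := k) K.1 1 *
        MulOpposite.op (inc I ∘ₗ inclusion (hsub K) (hup K) ∘ₗ pr K.1) := by
      refine MulOpposite.unop_injective (LinearMap.ext fun g => ?_)
      rw [Finset.unop_sum, LinearMap.sum_apply]
      simp only [scalar_one]
      change inc I (p g) = ∑ K : S, inc I (inclusion (hsub K) (hup K)
        (pr K.1 (inc K.1 (pr K.1 g))))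
      simp only [pr_inc]
      rw [hp, map_sum]
    rw [hU]
    exact Submodule.sum_mem _ fun K _ => Submodule.subset_span
      ⟨_, ⟨K.1, (hS.1 K.2).mem_of_traceClosed hD, rfl⟩, _, rfl⟩
  · rintro _ ⟨J, hJ, rfl⟩ a
    let f : IntervalModule k J →ₗ[PosetAlgebra k P] IntervalModule k I :=
      pr I ∘ₗ a.unop ∘ₗ inc J
    have hf : ∀ m x, val (f m) x ≠ 0 → x ∈ T := fun m x hx => by
      rw [val_map] at hx
      have hc := right_ne_zero_of_mul hx
      exact ⟨(mem_of_coeff_ne_zero f hc).2, J, hJ, mapsAt_of_coeff_ne_zero f hc⟩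
    have hf' : ∀ K : S, ∀ m x, ∀ y ∈ K.1.carrier, x ≤ y → val (f m) x ≠ 0 → x ∈ K.1.carrier :=
      fun K m x y hy hxy hx => (hS.1 K.2).closed y hy x (hf m x hx) (Or.inr hxy)
    -- A map `f : V_J → V_I` with `J ∈ D` lands in the trace, so it is the sum of its restrictions
    -- to the components; `w` collects these and lifts `f` through `p`.
    let w : IntervalEndAlgebra k P :=
      MulOpposite.op (∑ K : S, inc K.1 ∘ₗ restrict K.1 f (hsub K) (hf' K) ∘ₗ pr J)
    refine Submodule.mem_span_singleton.2 ⟨w, ?_⟩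
    rw [scalar_one, scalar_one]
    refine MulOpposite.unop_injective (LinearMap.ext fun g => ?_)
    change inc I (p (w.unop g)) = inc I (f (pr J g))
    congr 1
    have hw : ∀ K : S, pr K.1 (w.unop g) = restrict K.1 f (hsub K) (hf' K) (pr J g) := by
      intro K
      change pr K.1 ((∑ K : S, inc K.1 ∘ₗ restrict K.1 f (hsub K) (hf' K) ∘ₗ pr J) g) = _
      rw [LinearMap.sum_apply, map_sum, Finset.sum_eq_single K]
      · exact pr_inc _ _
      · exact fun L _ h => pr_inc_of_ne (fun h' => h (Subtype.ext h')) _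
      · simp
    refine val_injective (funext fun x => ?_)
    by_cases hx : x ∈ T
    · obtain ⟨K, hxK, hK⟩ := exists_isComponent (traceSupport_convex D I) hx
      rw [hvalp ⟨K, hS.2 hK⟩ _ x hxK, hw ⟨K, hS.2 hK⟩]
      exact val_ofFun_of_mem (val (f (pr J g))) hxK
    · have h0 : val (f (pr J g)) x = 0 := by
        by_contra h
        exact hx (hf _ x h)
      rw [h0, hp, val_sum]
      refine Finset.sum_eq_zero fun K _ => ?_
      rw [val_inclusion]
      exact val_of_notMem _ fun h => hx ((hS.1 K.2).subset h)
  · intro M _ _ h₁ h₂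
    exact hd M (fun J hJ => h₁ _ ⟨J, hJ, rfl⟩) h₂
  · rintro _ ⟨J, hJ, rfl⟩
    exact hN J hJ

/-- Induction shrinking `C` to `∅`, where the vanishing condition is empty; each removal raises `d`
by one. -/
theorem exists_hasProjectiveDimensionLE_of_traceClosed (n : ℕ) (C : Set (PosetInterval P))
    (hn : C.ncard = n) (hC : TraceClosed C) (d : ℕ)
    (hd : ∀ (N : Type (max u v)) [AddCommGroup N] [Module (IntervalEndAlgebra k P) N],
      (∀ J ∈ C, ∀ n : N, scalar (k := k) J 1 • n = 0) →
        HasProjectiveDimensionLE (ModuleCat.of (IntervalEndAlgebra k P) N) d) :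
    ∃ d : ℕ, ∀ (N : Type (max u v)) [AddCommGroup N] [Module (IntervalEndAlgebra k P) N],
      HasProjectiveDimensionLE (ModuleCat.of (IntervalEndAlgebra k P) N) d := by
  induction n generalizing C d with
  | zero =>
    obtain rfl : C = ∅ := (Set.ncard_eq_zero (Set.toFinite C)).1 hn
    exact ⟨d, fun N _ _ => hd N fun J hJ => absurd hJ (Set.notMem_empty J)⟩
  | succ n ih =>
    obtain ⟨I, hI, hI'⟩ := hC.exists_diff_singleton
      (Set.nonempty_of_ncard_ne_zero (by rw [hn]; exact n.succ_ne_zero))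
    refine ih (C \ {I}) (by rw [Set.ncard_sdiff_singleton_of_mem hI, hn]; rfl) hI' (d + 1)
      fun N _ _ hN => hasProjectiveDimensionLE_succ (I := I) hI' (fun M _ _ h₁ h₂ => hd M fun J hJ => ?_)
        N hN
    by_cases h : J = I
    · rw [h]
      exact h₂
    · exact h₁ J ⟨hJ, h⟩

variable (k P) in
theorem exists_hasProjectiveDimensionLE : ∃ d : ℕ,
    ∀ N : ModuleCat.{max u v} (IntervalEndAlgebra k P), HasProjectiveDimensionLE N d := by
  cases nonempty_fintype (PosetInterval P)
  -- The start is `C = univ`: the idempotents sum to `1`, so a module killed by all of them is zero.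
  obtain ⟨d, hd⟩ := exists_hasProjectiveDimensionLE_of_traceClosed (k := k) (P := P) _ Set.univ rfl
    (fun _ _ => Set.mem_univ _) 0 fun N _ _ hN => by
      have : Subsingleton N := subsingleton_of_forall_eq 0 fun n => by
        rw [smul_eq_sum (k := k) (P := P) n]
        exact Finset.sum_eq_zero fun I _ => hN I (Set.mem_univ I) n
      exact hasProjectiveDimensionLE_zero_of_subsingleton N
  exact ⟨d, fun N => hd N⟩

variable (k P) in
/-- The embedding of the incidence algebra as a sum of the interval modules of principal upward
closed intervals. -/
noncomputable def ofAlgebra [Fintype P] :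
    PosetAlgebra k P →ₗ[PosetAlgebra k P] IntervalGenerator k P :=
  ∑ x, inc (upper x) ∘ₗ LinearMap.toSpanSingleton (PosetAlgebra k P) _
    (ofFun (upper x) fun y => if y = x then 1 else 0)

variable (k P) in
/-- The projection onto the summand `ofAlgebra`. -/
noncomputable def toAlgebra [Fintype P] :
    IntervalGenerator k P →ₗ[PosetAlgebra k P] PosetAlgebra k P where
  toFun g := MulOpposite.op ⟨fun x y => val (pr (upper x) g : IntervalModule k (upper x)) y,
    fun _ _ h => val_of_notMem _ h⟩
  map_add' g h := MulOpposite.unop_injective (IncidenceAlgebra.ext fun x y _ => by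
    change val (pr (upper x) (g + h)) y = val (pr (upper x) g) y + val (pr (upper x) h) y
    rw [map_add, val_add])
  map_smul' a g := MulOpposite.unop_injective (IncidenceAlgebra.ext fun x y hxy => by
    rw [RingHom.id_apply, smul_eq_mul, MulOpposite.unop_mul, IncidenceAlgebra.mul_apply]
    change val (pr (upper x) (a • g)) y = ∑ z ∈ Finset.Icc x y, val (pr (upper x) g) z * a.unop z y
    rw [map_smul, val_smul_of_mem _ _ (I := upper x) hxy]
    -- Only `z` in `[x, y]` contribute: the value at `z` vanishes unless `x ≤ z`, and the entry of
    -- `a` vanishes unless `z ≤ y`.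
    symm
    refine (Finset.sum_subset (Finset.subset_univ _) fun z _ hz => ?_).trans
      (Finset.sum_congr rfl fun z _ => mul_comm _ _)
    by_cases hxz : x ≤ z
    · rw [IncidenceAlgebra.apply_eq_zero_of_not_le
        (fun hzy => hz (Finset.mem_Icc.2 ⟨hxz, hzy⟩)), mul_zero]
    · rw [val_of_notMem _ (I := upper x) hxz, zero_mul])

theorem toAlgebra_comp_ofAlgebra [Fintype P] : toAlgebra k P ∘ₗ ofAlgebra k P = LinearMap.id := by
  refine LinearMap.ext fun a => MulOpposite.unop_injective (IncidenceAlgebra.ext fun x y hxy => ?_)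
  change val (pr (upper x) (ofAlgebra k P a)) y = a.unop x y
  have h : pr (upper x) (ofAlgebra k P a) =
      a • ofFun (upper x) fun y => if y = x then (1 : k) else 0 := by
    rw [ofAlgebra, LinearMap.sum_apply, map_sum, Finset.sum_eq_single x]
    · exact pr_inc _ _
    · exact fun z _ hz => pr_inc_of_ne (fun h => hz (upper_injective h)) _
    · simp
  rw [h, val_smul_of_mem _ _ (I := upper x) hxy, Finset.sum_eq_single x]
  · rw [val_ofFun_of_mem _ (I := upper x) (le_refl x), if_pos rfl, mul_one]
  · intro z _ hz
    by_cases hxz : x ≤ z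
    · rw [val_ofFun_of_mem _ (I := upper x) hxz, if_neg hz, mul_zero]
    · rw [val_of_notMem _ (I := upper x) hxz, mul_zero]
  · simp

end IntervalGenerator

instance finite_posetAlgebra : Module.Finite k (PosetAlgebra k P) := by
  let f : PosetAlgebra k P →ₗ[k] (P → P → k) :=
    { toFun := fun a x y => a.unop x y
      map_add' := fun _ _ => rfl
      map_smul' := fun _ _ => rfl }
  refine FiniteDimensional.of_injective f fun a b h => MulOpposite.unop_injective ?_
  exact IncidenceAlgebra.ext fun x y _ => congrFun (congrFun h x) y

end IntervalGenerator

theorem mainTheorem1 (k : Type u) (P : Type v) [Field k] [PartialOrder P]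
    [Finite P] [DecidableEq P] [LocallyFiniteOrder P] :
    globalDimension (IntervalEndAlgebra k P) ≠ ⊤ ∧
    intervalResolutionGlobalDimension k P ≠ ⊤ ∧
    (∀ (Q : Type (max u v)) [AddCommGroup Q] [Module (PosetAlgebra k P) Q],
      Module.Finite (PosetAlgebra k P) Q → Module.Projective (PosetAlgebra k P) Q →
        InAdd (A := PosetAlgebra k P) (IntervalGenerator k P) Q) := by
  cases nonempty_fintype P
  obtain ⟨d, hd⟩ := IntervalGenerator.exists_hasProjectiveDimensionLE k P
  refine ⟨?_, ?_, fun Q _ _ _ _ => InAdd.of_projective (IntervalGenerator.ofAlgebra k P)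
    (IntervalGenerator.toAlgebra k P) IntervalGenerator.toAlgebra_comp_ofAlgebra⟩
  · have h : globalDimension (IntervalEndAlgebra k P) ≤ (d : WithBot ℕ∞) :=
      iSup_le fun M => (projectiveDimension_le_iff M d).2 (hd M)
    intro h'
    rw [h', top_le_iff] at h
    exact ENat.natCast_ne_top d (WithBot.coe_injective h)
  · have h := resolutionGlobalDimension_le k (IntervalGenerator.ofAlgebra k P)
      (IntervalGenerator.toAlgebra k P) IntervalGenerator.toAlgebra_comp_ofAlgebra hd
    exact ne_top_of_le_ne_top (ENat.natCast_ne_top d) h
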